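/- A semigroup variety is a class of semigroups defined by a set of identities $\mathbf u\approx\mathbf v$, where $\mathbf u,\mathbf v$ are words, i.e. elements of the free semigroup over $\{x_1,x_2,\dots\}$. Varieties, ordered by inclusion, form a lattice with $\mathbf X\wedge\mathbf Y=\mathbf X\cap\mathbf Y$ and $\mathbf X\vee\mathbf Y$ the variety generated by $\mathbf X\cup\mathbf Y$; $\mathbf{SEM}$ is the variety of all semigroups. A variety is overcommutative if it contains all commutative semigroups; the overcommutative varieties form a sublattice $\mathbb{OC}$. An element $x$ of a lattice $L$ is cancellable if, for all $y,z\in L$, $x\vee y=x\vee z$ and $x\wedge y=x\wedge z$ imply $y=z$. For integers $2\le m\le n$ let $\Lambda_{n,m}$ be the set of partitions $\lambda=(\ell_1\ge\ell_2\ge\dots\ge\ell_m\ge 1)$ of $n$ into $m$ parts, and let $\Lambda=\bigcup_{2\le m\le n}\Lambda_{n,m}$. For $\lambda\in\Lambda_{n,m}$ let the transversal $W_{n,m,\lambda}$ be the set of all words of length $n$ in which exactly the letters $x_1,\dots,x_m$ occur, the numbers of occurrences of $x_1,\dots,x_m$ are non-increasing, and these numbers form the partition $\lambda$. An overcommutative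 variety $\mathbf V$ reduces [collapses] $W_{n,m,\lambda}$ if it satisfies some identity $\mathbf u\approx\mathbf v$ with $\mathbf u\ne\mathbf v$ [all identities $\mathbf u\approx\mathbf v$] with $\mathbf u,\mathbf v\in W_{n,m,\lambda}$; it is greedy if it collapses every transversal it reduces. For $\lambda\in\Lambda_{n,m}$ let $q(\lambda)$ be the number of parts equal to $1$, let $r(\lambda)$ be the sum of the parts greater than $1$, and let $s(\lambda)=\max\{r(\lambda)-q(\lambda)-\delta,0\}$, where $\delta=0$ if $\lambda=(2,1)$ and $\delta=1$ otherwise. Let $\lambda^i\in\Lambda_{n+i,m+i}$ be $\lambda$ followed by $i$ parts equal to $1$. Let $\mathbf W_{n,m,\lambda}$ be the variety defined by all identities $\mathbf u\approx\mathbf v$ with $\mathbf u,\mathbf v\in W_{n,m,\lambda}$, and let $\mathbf S_\lambda=\bigwedge_{i=0}^{s(\lambda)}\mathbf W_{n+i,m+i,\lambda^i}$. Theorem. For an overcommutative semigroup variety $\mathbf V$, the following are equivalent: (a) $\mathbf V$ is a cancellable element of the lattice $\mathbb{OC}$; (b) $\mathbf V$ is greedy; (c) either $\mathbf V=\mathbf{SEM}$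 or $\mathbf V=\bigwedge_{i=1}^k\mathbf S_{\lambda_i}$ for some $k\ge 1$ and some $\lambda_1,\dots,\lambda_k\in\Lambda$. -/

import Mathlib

universe u

/-- An element `x` of a lattice is cancellable if `y` is determined by `x ⊔ y` and `x ⊓ y`. -/
def IsCancellableElement {L : Type*} [Lattice L] (x : L) : Prop :=
  ∀ y z : L, x ⊔ y = x ⊔ z → x ⊓ y = x ⊓ z → y = z

/-- Words: elements of the free semigroup over the countably infinite alphabet `x₁, x₂, …`.
The letter `x_{i+1}` is represented by the natural number `i`. -/
abbrev Word : Type := FreeSemigroup ℕ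

namespace Word

/-- The sequence of letters of a word. -/
def letters (w : Word) : List ℕ := w.head :: w.tail

/-- `w.occ i` is the number of occurrences of the letter `i` in `w`. -/
def occ (w : Word) (i : ℕ) : ℕ := w.letters.count i

/-- The set of letters occurring in `w`. -/
def con (w : Word) : Finset ℕ := w.letters.toFinset

/-- The numbers of occurrences of the letters of `w`, in non-increasing order. -/
def part (w : Word) : List ℕ := (w.con.val.map w.occ).sort (· ≥ ·)

end Word

/-- `S` satisfies the identity `e.1 ≈ e.2`. -/
def SatisfiesIdentity (S : Type u) [Semigroup S] (e : Word × Word) : Prop :=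
  ∀ φ : ℕ → S, FreeSemigroup.lift φ e.1 = FreeSemigroup.lift φ e.2

/-- A semigroup variety: a class of semigroups that is defined by a set of identities. -/
structure SemigroupVariety : Type (u + 1) where
  /-- membership of a semigroup in the variety -/
  Mem : ∀ (S : Type u) [Semigroup S], Prop
  exists_identities : ∃ E : Set (Word × Word), ∀ (S : Type u) [Semigroup S],
    Mem S ↔ ∀ e ∈ E, SatisfiesIdentity S e

namespace SemigroupVariety

/-- The variety given by an identity system. -/
def var (E : Set (Word × Word)) : SemigroupVariety.{u} where
  Mem S _ := ∀ e ∈ E, SatisfiesIdentity S e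
  exists_identities := ⟨E, fun _ _ => Iff.rfl⟩

/-- The variety `V` satisfies the identity `e.1 ≈ e.2`. -/
def Satisfies (V : SemigroupVariety.{u}) (e : Word × Word) : Prop :=
  ∀ (S : Type u) [Semigroup S], V.Mem S → SatisfiesIdentity S e

@[ext]
theorem ext {V W : SemigroupVariety.{u}}
    (h : ∀ (S : Type u) [Semigroup S], V.Mem S ↔ W.Mem S) : V = W := by
  cases V
  cases W
  congr
  funext S _
  exact propext (h S)

/-- Varieties are ordered by inclusion. -/
instance : PartialOrder SemigroupVariety.{u} where
  le V W := ∀ (S : Type u) [Semigroup S], V.Mem S → W.Mem S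
  le_refl _ _ _ h := h
  le_trans _ _ _ h₁ h₂ S _ h := h₂ S (h₁ S h)
  le_antisymm _ _ h₁ h₂ := ext fun S _ => ⟨h₁ S, h₂ S⟩

/-- The lattice of semigroup varieties. The meet is the intersection. The join is the variety
generated by the union, i.e. the variety given by all identities that hold in both varieties. -/
instance : Lattice SemigroupVariety.{u} where
  inf V W :=
    { Mem := fun S _ => V.Mem S ∧ W.Mem S
      exists_identities := by
        obtain ⟨E, hE⟩ := V.exists_identities
        obtain ⟨F, hF⟩ := W.exists_identities
        refine ⟨E ∪ F, fun S _ => ?_⟩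
        rw [hE, hF]
        constructor
        · rintro ⟨h₁, h₂⟩ e (he | he)
          exacts [h₁ e he, h₂ e he]
        · exact fun h => ⟨fun e he => h e (Or.inl he), fun e he => h e (Or.inr he)⟩ }
  inf_le_left _ _ _ _ h := h.1
  inf_le_right _ _ _ _ h := h.2
  le_inf _ _ _ h₁ h₂ S _ h := ⟨h₁ S h, h₂ S h⟩
  sup V W := var {e | V.Satisfies e ∧ W.Satisfies e}
  le_sup_left _ _ S _ h _ he := he.1 S h
  le_sup_right _ _ S _ h _ he := he.2 S h
  sup_le _ _ U h₁ h₂ S _ h := by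
    obtain ⟨E, hE⟩ := U.exists_identities
    exact (hE S).2 fun e he => h e
      ⟨fun T _ hT => (hE T).1 (h₁ T hT) e he, fun T _ hT => (hE T).1 (h₂ T hT) e he⟩

/-- The greatest element `⊤` is the variety of all semigroups. -/
instance : OrderTop SemigroupVariety.{u} where
  top :=
    { Mem := fun _ _ => True
      exists_identities := ⟨∅, fun _ _ => by simp⟩ }
  le_top _ _ _ _ := trivial

/-- The variety of all semigroups. -/
def SEM : SemigroupVariety.{u} := ⊤

/-- `V` contains all commutative semigroups. -/
def IsOvercommutative (V : SemigroupVariety.{u}) : Prop :=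
  ∀ (S : Type u) [Semigroup S], (∀ a b : S, a * b = b * a) → V.Mem S

/-- The lattice of overcommutative varieties, as a sublattice of the lattice of all semigroup
varieties. -/
def OC : Sublattice SemigroupVariety.{u} where
  carrier := {V | V.IsOvercommutative}
  supClosed' V hV W _ := fun S _ hS => (le_sup_left : V ≤ V ⊔ W) S (hV S hS)
  infClosed' _ hV _ hW := fun S _ hS => ⟨hV S hS, hW S hS⟩

/-- A partition of a number `n` into `m` parts, `2 ≤ m ≤ n`: a non-increasing sequence of `m`
positive integers whose sum is `n`. -/
structure Part where
  parts : List ℕ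
  sorted : parts.Pairwise (· ≥ ·)
  pos : ∀ l ∈ parts, 0 < l
  two_le : 2 ≤ parts.length

namespace Part

/-- The partitioned number. -/
def n (l : Part) : ℕ := l.parts.sum

/-- The number of parts. -/
def m (l : Part) : ℕ := l.parts.length

/-- The number of parts equal to `1`. -/
def q (l : Part) : ℕ := l.parts.count 1

/-- The sum of the parts greater than `1`. -/
def r (l : Part) : ℕ := (l.parts.filter (1 < ·)).sum

/-- `δ` is `0` for the partition `(2, 1)` and `1` for all others. -/
def delta (l : Part) : ℕ := if l.parts = [2, 1] then 0 else 1

/-- `s = max {r - q - δ, 0}`. -/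
def s (l : Part) : ℕ := (max ((l.r : ℤ) - l.q - l.delta) 0).toNat

/-- The partition obtained by appending `k` parts equal to `1`. -/
def appendOnes (l : Part) (k : ℕ) : Part where
  parts := l.parts ++ List.replicate k 1
  sorted := by
    refine List.pairwise_append.2 ⟨l.sorted, by simp [List.pairwise_replicate], ?_⟩
    intro a ha b hb
    rw [List.eq_of_mem_replicate hb]
    exact l.pos a ha
  pos := by
    intro a ha
    rcases List.mem_append.1 ha with h | h
    · exact l.pos a h
    · rw [List.eq_of_mem_replicate h]
      exact Nat.one_pos
  two_le := by
    rw [List.length_append]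
    exact l.two_le.trans (Nat.le_add_right _ _)

/-- The transversal of a partition `l` of `n` into `m` parts: the words of length `n` in exactly
the first `m` letters, whose numbers of occurrences do not increase and form the partition `l`. -/
def transversal (l : Part) : Set Word :=
  {w | w.length = l.n ∧ w.con = Finset.range l.m ∧
    (∀ i, i + 1 < l.m → w.occ (i + 1) ≤ w.occ i) ∧ w.part = l.parts}

/-- The variety given by all identities `u ≈ v` with `u` and `v` in the transversal of `l`. -/
def varietyW (l : Part) : SemigroupVariety.{u} :=
  var (l.transversal ×ˢ l.transversal)

/-- The meet of the varieties `varietyW` of `l` extended by `0, 1, …, s` parts equal to `1`. -/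
def varietyS (l : Part) : SemigroupVariety.{u} :=
  (Finset.range (l.s + 1)).inf fun i => (l.appendOnes i).varietyW

end Part

/-- `V` satisfies some non-trivial identity between words of the transversal of `l`. -/
def Reduces (V : SemigroupVariety.{u}) (l : Part) : Prop :=
  ∃ u ∈ l.transversal, ∃ v ∈ l.transversal, u ≠ v ∧ V.Satisfies (u, v)

/-- `V` satisfies all identities between words of the transversal of `l`. -/
def Collapses (V : SemigroupVariety.{u}) (l : Part) : Prop :=
  ∀ u ∈ l.transversal, ∀ v ∈ l.transversal, V.Satisfies (u, v)

/-- `V` collapses every transversal that it reduces. -/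
def IsGreedy (V : SemigroupVariety.{u}) : Prop :=
  ∀ l : Part, V.Reduces l → V.Collapses l

end SemigroupVariety

/-! Overcommutative varieties satisfy only balanced identities: the two sides are rearrangements of
each other. The type of a word is the partition formed by its letter multiplicities. Since
identities may be renamed, greediness says that a variety with one nontrivial identity between
rearrangements of a given type has all of them in that type.

Greedy implies cancellable. Suppose `Y` satisfies `u ≈ v`. If `V` has a nontrivial identity in the
type of `u`, it satisfies `u ≈ v`, and so does `V ⊔ Y = V ⊔ Z`. Otherwise, in a derivation of `u ≈
v` from the identities of `V` and `Z`, which exists because `V ⊓ Y = V ⊓ Z`, every step taken from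
`V` is trivial. Either way `Z` satisfies `u ≈ v`.

Cancellable implies greedy. The criterion `not_isCancellableElement` compares two varieties, each
given by one pair of words of the same type together with all balanced identities above that type.
If `V` links the pairs termwise but does not identify the words of a pair, the two varieties have
equal joins and equal meets with `V`; they differ unless one pair renames the other. For words with
a repeated letter, three renaming classes of rearrangements exist and a counting argument forces
collapse. For words without repetition, all rearrangements are renamings of each other, and the
criterion becomes a statement about permutations commuting with transpositions.

Greedy is equivalent to (c). Collapsing a type is inherited by adding linear letters: automatically
in a greedy variety, and from the defining identities in `varietyS` because `s` is large enough for
`CollapsesCounts.cons_one` to take over. Hence the identities of a meet of varieties `varietyS` are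
the trivial ones and the balanced ones between words dominated by one of the partitions
(`satisfies_inf_varietyS`). Higman's lemma reduces the collapsed partitions of a greedy variety to
finitely many. -/

namespace Word

/-! ### Words as lists, and congruences on the free semigroup -/

theorem letters_mul (u v : Word) : (u * v).letters = u.letters ++ v.letters := rfl

theorem letters_ne_nil (u : Word) : u.letters ≠ [] := List.cons_ne_nil _ _

theorem letters_injective : Function.Injective letters := by
  rintro ⟨a, l⟩ ⟨b, l'⟩ h
  simpa [letters] using h

theorem exists_letters_eq {l : List ℕ} (hl : l ≠ []) : ∃ u : Word, u.letters = l := by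
  cases l with
  | nil => exact absurd rfl hl
  | cons a l => exact ⟨⟨a, l⟩, rfl⟩

theorem letters_lift (φ : ℕ → Word) (u : Word) :
    letters (FreeSemigroup.lift φ u) = u.letters.flatMap fun i => (φ i).letters := by
  induction u using FreeSemigroup.recOnMul with
  | ih1 i => simp [letters]
  | ih2 x y hx hy => rw [map_mul, letters_mul, hx, hy, letters_mul, List.flatMap_append]

/-- The congruence on words given by an equivalence relation on lists that is compatible with
concatenation. -/
def conOfList (r : List ℕ → List ℕ → Prop) (hr : Equivalence r)
    (happ : ∀ a b l l', r l l' → r (a ++ l ++ b) (a ++ l' ++ b)) : Con Word where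
  r u v := r u.letters v.letters
  iseqv := ⟨fun _ => hr.refl _, hr.symm, hr.trans⟩
  mul' {w x y z} h₁ h₂ := by
    have h₃ := happ [] y.letters _ _ h₁
    have h₄ := happ x.letters [] _ _ h₂
    simp only [List.nil_append, List.append_nil] at h₃ h₄
    exact hr.trans h₃ h₄

end Word

/-! ### Evaluation of words and deduction of identities -/

/-- The value of a possibly empty word under a substitution of elements of a semigroup. -/
def evalList {S : Type*} [Semigroup S] (φ : ℕ → S) (l : List ℕ) : WithOne S :=
  (l.map fun i => (φ i : WithOne S)).prod

section evalList

variable {S : Type*} [Semigroup S] (φ : ℕ → S)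

theorem evalList_append (l l' : List ℕ) :
    evalList φ (l ++ l') = evalList φ l * evalList φ l' := by
  simp [evalList]

theorem evalList_letters (u : Word) :
    evalList φ u.letters = (FreeSemigroup.lift φ u : S) := by
  induction u using FreeSemigroup.recOnMul with
  | ih1 i => simp [Word.letters, evalList]
  | ih2 x y hx hy => rw [map_mul, WithOne.coe_mul, ← hx, ← hy, ← evalList_append]; rfl

theorem evalList_flatMap (ψ : ℕ → Word) (l : List ℕ) :
    evalList φ (l.flatMap fun i => (ψ i).letters) =
      evalList (fun i => FreeSemigroup.lift φ (ψ i)) l := by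
  induction l with
  | nil => rfl
  | cons a l ih =>
    rw [List.flatMap_cons, evalList_append, ih, evalList_letters]
    simp [evalList]

theorem evalList_map (f : ℕ → ℕ) (l : List ℕ) :
    evalList φ (l.map f) = evalList (fun i => φ (f i)) l := by
  simp [evalList, Function.comp_def]

theorem evalList_perm {S : Type*} [Semigroup S] (hS : ∀ a b : S, a * b = b * a) (φ : ℕ → S)
    {l l' : List ℕ} (h : l.Perm l') : evalList φ l = evalList φ l' := by
  let _ : CommSemigroup S := { mul_comm := hS }
  exact (h.map _).prod_eq

end evalList

theorem satisfiesIdentity_iff {S : Type u} [Semigroup S] {u v : Word} :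
    SatisfiesIdentity S (u, v) ↔ ∀ φ : ℕ → S, evalList φ u.letters = evalList φ v.letters := by
  simp only [evalList_letters, WithOne.coe_inj]
  rfl

/-- Elements of the quotient are classes of words, so assignments are substitutions. `ULift` moves
the quotient into the universe of the variety. -/
theorem satisfiesIdentity_quotient {c : Con Word} {e : Word × Word} :
    SatisfiesIdentity (ULift.{u} c.Quotient) e ↔
      ∀ φ : ℕ → Word, c (FreeSemigroup.lift φ e.1) (FreeSemigroup.lift φ e.2) := by
  have key (φ : ℕ → Word) (w : Word) :
      FreeSemigroup.lift (fun i => (ULift.up (φ i : c.Quotient) : ULift.{u} c.Quotient)) w =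
        ULift.up ((FreeSemigroup.lift φ w : Word) : c.Quotient) := by
    induction w using FreeSemigroup.recOnMul with
    | ih1 i => simp
    | ih2 x y hx hy => rw [map_mul, hx, hy, map_mul, Con.coe_mul]; rfl
  constructor
  · intro h φ
    have := h fun i => ULift.up (φ i : c.Quotient)
    rw [key, key, ULift.up_inj, Con.eq] at this
    exact this
  · intro h φ
    have hφ : ∀ i, ∃ w : Word, φ i = ULift.up (w : c.Quotient) := fun i => by
      obtain ⟨w, hw⟩ := Quotient.exists_rep (φ i).down
      exact ⟨w, ULift.ext _ _ hw.symm⟩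
    choose ψ hψ using hφ
    rw [funext hψ, key, key, ULift.up_inj, Con.eq]
    exact h ψ

namespace SemigroupVariety

/-- The variety `V` satisfies the identity `l ≈ l'` between possibly empty words. -/
def SatisfiesList (V : SemigroupVariety.{u}) (l l' : List ℕ) : Prop :=
  ∀ (S : Type u) [Semigroup S], V.Mem S → ∀ φ : ℕ → S, evalList φ l = evalList φ l'

variable {V W : SemigroupVariety.{u}} {l l' l'' : List ℕ}

theorem satisfies_iff {u v : Word} : V.Satisfies (u, v) ↔ V.SatisfiesList u.letters v.letters := by
  simp only [Satisfies, satisfiesIdentity_iff, SatisfiesList]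

namespace SatisfiesList

theorem refl (V : SemigroupVariety.{u}) (l : List ℕ) : V.SatisfiesList l l := fun _ _ _ _ => rfl

theorem symm (h : V.SatisfiesList l l') : V.SatisfiesList l' l := fun S _ hS φ => (h S hS φ).symm

theorem trans (h : V.SatisfiesList l l') (h' : V.SatisfiesList l' l'') : V.SatisfiesList l l'' :=
  fun S _ hS φ => (h S hS φ).trans (h' S hS φ)

theorem mono (h : V.SatisfiesList l l') (hW : W ≤ V) : W.SatisfiesList l l' :=
  fun S _ hS => h S (hW S hS)

theorem append (h : V.SatisfiesList l l') (a b : List ℕ) :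
    V.SatisfiesList (a ++ l ++ b) (a ++ l' ++ b) := fun S _ hS φ => by
  simp only [evalList_append, h S hS φ]

theorem append_left (h : V.SatisfiesList l l') (a : List ℕ) :
    V.SatisfiesList (a ++ l) (a ++ l') := by
  simpa using h.append a []

theorem append_right (h : V.SatisfiesList l l') (b : List ℕ) :
    V.SatisfiesList (l ++ b) (l' ++ b) := h.append [] b

theorem flatMap (h : V.SatisfiesList l l') (ψ : ℕ → Word) :
    V.SatisfiesList (l.flatMap fun i => (ψ i).letters) (l'.flatMap fun i => (ψ i).letters) :=
  fun S _ hS φ => by simp only [evalList_flatMap]; exact h S hS _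

theorem map (h : V.SatisfiesList l l') (f : ℕ → ℕ) : V.SatisfiesList (l.map f) (l'.map f) :=
  fun S _ hS φ => by simp only [evalList_map]; exact h S hS _

theorem map_perm_iff (σ : Equiv.Perm ℕ) :
    V.SatisfiesList (l.map σ) (l'.map σ) ↔ V.SatisfiesList l l' := by
  refine ⟨fun h => ?_, fun h => h.map σ⟩
  simpa [Function.comp_def] using h.map σ.symm

end SatisfiesList

theorem exists_eq_var (V : SemigroupVariety.{u}) : ∃ E, V = var E :=
  let ⟨E, hE⟩ := V.exists_identities
  ⟨E, ext hE⟩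

theorem le_iff_satisfies : V ≤ W ↔ ∀ u v, W.Satisfies (u, v) → V.Satisfies (u, v) := by
  constructor
  · exact fun h u v huv S _ hS => huv S (h S hS)
  · intro h S _ hS
    obtain ⟨E, rfl⟩ := W.exists_eq_var
    exact fun e he => h e.1 e.2 (fun T _ hT => hT e he) S hS

/-- An identity that follows from a system belongs to every congruence on the free semigroup that
contains all substitution instances of the system. -/
theorem rel_of_satisfies_var {E : Set (Word × Word)} {c : Con Word}
    (hc : ∀ e ∈ E, ∀ φ : ℕ → Word, c (FreeSemigroup.lift φ e.1) (FreeSemigroup.lift φ e.2))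
    {u v : Word} (h : (var.{u} E).Satisfies (u, v)) : c u v := by
  -- The quotient by `c` lies in the variety; sending each letter to its own class turns the
  -- identity into `c u v`.
  have := satisfiesIdentity_quotient.1
    (h (ULift.{u} c.Quotient) fun e he => satisfiesIdentity_quotient.2 (hc e he)) FreeSemigroup.of
  have hid : FreeSemigroup.lift (FreeSemigroup.of : ℕ → Word) = MulHom.id Word :=
    FreeSemigroup.lift_comp_of' (MulHom.id Word)
  simpa [hid] using this

theorem IsOvercommutative.perm (hV : V.IsOvercommutative) {u v : Word}
    (h : V.Satisfies (u, v)) : u.letters.Perm v.letters := by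
  -- The quotient by this congruence is the free commutative semigroup, a member of `V`.
  let c : Con Word := Word.conOfList List.Perm ⟨.refl, .symm, .trans⟩
    fun a b l l' h => (h.append_left a).append_right b
  have hcomm (a b : ULift.{u} c.Quotient) : a * b = b * a := by
    obtain ⟨⟨x⟩⟩ := a
    obtain ⟨⟨y⟩⟩ := b
    refine ULift.ext _ _ ((Con.eq c).2 ?_)
    exact List.perm_append_comm (l₁ := x.letters) (l₂ := y.letters)
  have := satisfiesIdentity_quotient.1 (h _ (hV _ hcomm)) FreeSemigroup.of
  have hid : FreeSemigroup.lift (FreeSemigroup.of : ℕ → Word) = MulHom.id Word :=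
    FreeSemigroup.lift_comp_of' (MulHom.id Word)
  have huv : c u v := by simpa [hid] using this
  exact huv

theorem isOvercommutative_var {E : Set (Word × Word)}
    (hE : ∀ e ∈ E, e.1.letters.Perm e.2.letters) : (var.{u} E).IsOvercommutative :=
  fun _ _ hS e he => satisfiesIdentity_iff.2 fun φ => evalList_perm hS φ (hE e he)

end SemigroupVariety

/-! ### Types of words and renaming of letters -/

/-- The multiset of the numbers of occurrences of the letters of a list. -/
def letterCounts (l : List ℕ) : Multiset ℕ := l.toFinset.val.map fun i => l.count i

section letterCounts

variable {l l' : List ℕ}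

theorem letterCounts_perm (h : l.Perm l') : letterCounts l = letterCounts l' := by
  simp only [letterCounts, List.toFinset_eq_of_perm _ _ h, h.count_eq]

theorem sum_letterCounts (l : List ℕ) : (letterCounts l).sum = l.length :=
  List.sum_toFinset_count_eq_length l

theorem pos_of_mem_letterCounts {a : ℕ} (h : a ∈ letterCounts l) : 0 < a := by
  obtain ⟨i, hi, rfl⟩ := Multiset.mem_map.1 h
  exact List.count_pos_iff.2 (List.mem_toFinset.1 hi)

theorem letterCounts_replicate_append {x a : ℕ} (ha : 0 < a) (hx : x ∉ l) :
    letterCounts (List.replicate a x ++ l) = a ::ₘ letterCounts l := by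
  have h : (List.replicate a x ++ l).toFinset = Finset.cons x l.toFinset (by simpa using hx) := by
    ext i
    simp [ha.ne']
  rw [letterCounts, h, Finset.cons_val, Multiset.map_cons]
  congr 1
  · simp [List.count_eq_zero.2 hx]
  · refine Multiset.map_congr rfl fun i hi => ?_
    have : x ≠ i := by
      rintro rfl
      exact hx (List.mem_toFinset.1 hi)
    simp [List.count_replicate, this]

theorem letterCounts_cons {x : ℕ} (hx : x ∉ l) : letterCounts (x :: l) = 1 ::ₘ letterCounts l :=
  letterCounts_replicate_append Nat.one_pos hx

theorem exists_perm_replicate_append {b : ℕ} {s : Multiset ℕ} (h : letterCounts l = b ::ₘ s) :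
    ∃ x l', l.Perm (List.replicate b x ++ l') ∧ x ∉ l' ∧ letterCounts l' = s := by
  have hb : b ∈ letterCounts l := h ▸ Multiset.mem_cons_self b s
  obtain ⟨x, -, rfl⟩ := Multiset.mem_map.1 hb
  have hp := (List.filter_append_perm (fun y => decide (y = x)) l).symm
  rw [List.filter_eq] at hp
  refine ⟨x, _, hp, by simp, ?_⟩
  rw [letterCounts_perm hp,
    letterCounts_replicate_append (pos_of_mem_letterCounts hb) (by simp)] at h
  exact (Multiset.cons_inj_right _).1 h

theorem exists_letterCounts_eq (μ : List ℕ) (hμ : ∀ a ∈ μ, 0 < a) :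
    ∃ l, letterCounts l = μ := by
  induction μ with
  | nil => exact ⟨[], rfl⟩
  | cons a μ ih =>
    obtain ⟨l, hl⟩ := ih fun b hb => hμ b (List.mem_cons_of_mem _ hb)
    obtain ⟨x, hx⟩ := Infinite.exists_notMem_finset l.toFinset
    refine ⟨List.replicate a x ++ l, ?_⟩
    rw [letterCounts_replicate_append (hμ a (by simp)) (by simpa using hx), hl]
    rfl

theorem exists_nodup_map_count {μ : List ℕ} (h : letterCounts l = μ) :
    ∃ us : List ℕ, us.Nodup ∧ (∀ i, i ∈ us ↔ i ∈ l) ∧ us.map (fun i => l.count i) = μ := by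
  have h₁ : μ.Perm (l.toFinset.toList.map fun i => l.count i) := by
    rw [← Multiset.coe_eq_coe, ← h, ← Multiset.map_coe, Finset.coe_toList]
    rfl
  obtain ⟨us, h₂, h₃⟩ := (congrFun₂ (List.eq_map_comp_perm _) _ _).mpr h₁
  exact ⟨us, h₃.nodup_iff.2 (Finset.nodup_toList _), fun i => by simp [h₃.mem_iff], h₂.symm⟩

end letterCounts

/-- An injection of a finite set of letters into the alphabet extends to a permutation. -/
theorem exists_perm_extending (s : Finset ℕ) (f : ℕ → ℕ) (hf : Set.InjOn f s) :
    ∃ σ : Equiv.Perm ℕ, ∀ x ∈ s, σ x = f x := by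
  induction s using Finset.induction_on with
  | empty => exact ⟨1, by simp⟩
  | insert a s ha ih =>
    obtain ⟨σ, hσ⟩ := ih (hf.mono (by simp))
    refine ⟨Equiv.swap (σ a) (f a) * σ, fun x hx => ?_⟩
    rcases Finset.mem_insert.1 hx with rfl | hx'
    · simp
    · have hxa : x ≠ a := fun h => ha (h ▸ hx')
      rw [Equiv.Perm.mul_apply, Equiv.swap_apply_of_ne_of_ne (σ.injective.ne hxa), hσ x hx']
      rw [hσ x hx']
      exact fun h => hxa (hf (by simp [hx']) (by simp) h)

namespace SemigroupVariety

namespace Part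

variable {l : Part}

theorem part_eq_iff {w : Word} : w.part = l.parts ↔ letterCounts w.letters = l.parts := by
  have h : (letterCounts w.letters).sort (· ≥ ·) = w.part := rfl
  constructor
  · intro hw
    rw [← hw, ← h, Multiset.sort_eq]
  · intro hw
    refine List.Perm.eq_of_pairwise (le := (· ≥ ·)) (fun a b _ _ h₁ h₂ => le_antisymm h₂ h₁)
      (Multiset.pairwise_sort _ _) l.sorted ?_
    rw [← Multiset.coe_eq_coe, ← hw]
    exact Multiset.sort_eq _ _

theorem map_getD_range (μ : List ℕ) : (List.range μ.length).map (fun i => μ.getD i 0) = μ :=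
  List.ext_getElem (by simp) fun i h₁ h₂ => by simp [List.getElem?_eq_getElem h₂]

/-- The occurrence numbers and the parts are non-increasing lists with the same multiset, hence
equal. The default `0` is the count of every letter outside the first `l.m`. -/
theorem occ_of_mem_transversal {w : Word} (hw : w ∈ l.transversal) (i : ℕ) :
    w.occ i = l.parts.getD i 0 := by
  obtain ⟨-, hcon, hmono, hpart⟩ := hw
  have h₁ : (List.range l.m).map w.occ = l.parts := by
    refine List.Perm.eq_of_pairwise (le := (· ≥ ·)) (fun a b _ _ h₁ h₂ => le_antisymm h₂ h₁)
      ?_ l.sorted ?_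
    · have hle : ∀ j, j < l.m → ∀ i ≤ j, w.occ j ≤ w.occ i := by
        intro j
        induction j with
        | zero => intro _ i hi; rw [Nat.le_zero.1 hi]
        | succ j ih =>
          intro hj i hi
          rcases Nat.lt_or_eq_of_le hi with hi | rfl
          · exact (hmono j hj).trans (ih (by lia) i (by lia))
          · exact le_rfl
      rw [List.pairwise_map]
      refine List.pairwise_lt_range.imp_of_mem fun {a b} _ hb hab => ?_
      exact hle b (List.mem_range.1 hb) a hab.le
    · rw [← Multiset.coe_eq_coe, ← part_eq_iff.1 hpart, letterCounts]
      have : w.letters.toFinset = Finset.range l.m := hcon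
      rw [this]
      rfl
  by_cases hi : i < l.m
  · have h₂ : i < l.parts.length := hi
    rw [List.getD_eq_getElem _ _ h₂]
    simp only [← h₁, List.getElem_map, List.getElem_range]
  · have h₂ : l.parts.length ≤ i := not_lt.1 hi
    rw [List.getD_eq_default _ _ h₂]
    refine List.count_eq_zero.2 fun h => hi ?_
    rw [← Finset.mem_range, ← hcon]
    exact List.mem_toFinset.2 h

theorem letterCounts_of_mem_transversal {w : Word} (hw : w ∈ l.transversal) :
    letterCounts w.letters = l.parts := part_eq_iff.1 hw.2.2.2

theorem perm_of_mem_transversal {v w : Word} (hv : v ∈ l.transversal) (hw : w ∈ l.transversal) :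
    v.letters.Perm w.letters := List.perm_iff_count.2 fun i =>
  (occ_of_mem_transversal hv i).trans (occ_of_mem_transversal hw i).symm

theorem getD_pos_iff {i : ℕ} : 0 < l.parts.getD i 0 ↔ i < l.m := by
  constructor
  · intro h
    by_contra hi
    rw [List.getD_eq_default _ _ (not_lt.1 hi)] at h
    exact h.false
  · intro h
    rw [List.getD_eq_getElem _ _ h]
    exact l.pos _ (List.getElem_mem _)

theorem mem_transversal_of_occ {w : Word} (hw : ∀ i, w.occ i = l.parts.getD i 0) :
    w ∈ l.transversal := by
  have hcon : w.con = Finset.range l.m := by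
    ext i
    rw [Finset.mem_range, ← getD_pos_iff, ← hw, Word.con, List.mem_toFinset, Word.occ,
      List.count_pos_iff]
  have hlc : letterCounts w.letters = l.parts := by
    have h₁ : w.letters.toFinset = Finset.range l.m := hcon
    rw [letterCounts, h₁]
    conv_rhs => rw [← map_getD_range l.parts]
    rw [← funext hw]
    rfl
  refine ⟨?_, hcon, fun i hi => ?_, part_eq_iff.2 hlc⟩
  · have h₁ := sum_letterCounts w.letters
    rw [hlc, Multiset.sum_coe] at h₁
    exact h₁.symm
  · rw [hw, hw, List.getD_eq_getElem _ _ hi, List.getD_eq_getElem _ _ (Nat.lt_of_succ_lt hi)]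
    exact List.pairwise_iff_getElem.1 l.sorted _ _ _ _ (Nat.lt_succ_self i)

/-- Words of the type `l` can be renamed to words of the transversal of `l`. -/
theorem exists_map_mem_transversal {p : List ℕ} (hp : letterCounts p = l.parts) :
    ∃ σ : Equiv.Perm ℕ, ∀ (w : Word) (p' : List ℕ), p'.Perm p → w.letters = p'.map σ →
      w ∈ l.transversal := by
  obtain ⟨us, hnd, hmem, hus⟩ := exists_nodup_map_count hp
  have hlen : us.length = l.parts.length := by rw [← hus, List.length_map]
  -- `us` lists the letters in the order of the parts, so each letter is renamed to its position
  -- there.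
  obtain ⟨σ, hσ⟩ := exists_perm_extending us.toFinset (fun x => us.idxOf x) (by
    intro x hx y _ hxy
    exact (List.idxOf_inj (by simpa using hx)).1 hxy)
  refine ⟨σ, fun w p' hp' hw => mem_transversal_of_occ fun i => ?_⟩
  rw [Word.occ, hw]
  by_cases hi : i < us.length
  · have h₁ : σ us[i] = i := by
      rw [hσ _ (by simp)]
      exact hnd.idxOf_getElem i hi
    have h₂ : i < l.parts.length := hlen ▸ hi
    conv_lhs => rw [← h₁]
    rw [List.count_map_of_injective _ _ σ.injective, hp'.count_eq, List.getD_eq_getElem _ _ h₂]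
    simp only [← hus, List.getElem_map]
  · rw [List.getD_eq_default _ _ (by lia), List.count_eq_zero]
    intro h
    obtain ⟨x, hx, rfl⟩ := List.mem_map.1 h
    have hx' : x ∈ us := (hmem x).2 (hp'.mem_iff.1 hx)
    rw [hσ x (by simpa using hx')] at hi
    exact hi (List.idxOf_lt_length_of_mem hx')

theorem ne_nil_of_letterCounts {p : List ℕ} (hp : letterCounts p = l.parts) : p ≠ [] := by
  rintro rfl
  have h₁ : l.parts = [] := by simpa [letterCounts] using hp.symm
  simpa [h₁] using l.two_le

/-- Every nontrivial rearrangement involves at least two letters. -/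
theorem exists_part {p p' : List ℕ} (h : p.Perm p') (hne : p ≠ p') :
    ∃ l : Part, letterCounts p = l.parts := by
  refine ⟨⟨(letterCounts p).sort (· ≥ ·), Multiset.pairwise_sort _ _,
    fun a ha => pos_of_mem_letterCounts ((Multiset.mem_sort _).1 ha), ?_⟩,
    (Multiset.sort_eq _ _).symm⟩
  rw [Multiset.length_sort, letterCounts, Multiset.card_map]
  change 2 ≤ p.toFinset.card
  by_contra hcard
  refine hne ?_
  have h₁ : p.toFinset.card ≤ 1 := by lia
  cases p with
  | nil => exact (List.nil_perm.1 h).symm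
  | cons a t =>
    have ha : ∀ b ∈ a :: t, b = a := fun b hb =>
      Finset.card_le_one.1 h₁ b (List.mem_toFinset.2 hb) a (by simp)
    rw [List.eq_replicate_of_mem ha, List.eq_replicate_of_mem fun b hb => ha b (h.mem_iff.2 hb),
      h.length_eq]

end Part

variable {V : SemigroupVariety.{u}} {l : Part}

/-- Satisfaction is invariant under permutations of the alphabet, so the normalised letters of the
transversal can be dropped. -/
theorem collapses_iff : V.Collapses l ↔
    ∀ p p' : List ℕ, letterCounts p = l.parts → p.Perm p' → V.SatisfiesList p p' := by
  constructor
  · intro h p p' hp hpp'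
    obtain ⟨σ, hσ⟩ := Part.exists_map_mem_transversal hp
    have hne := Part.ne_nil_of_letterCounts hp
    have hp₀ : p' ≠ [] := fun h => hne (show p.Perm [] from h ▸ hpp').eq_nil
    obtain ⟨u, hu⟩ := Word.exists_letters_eq (l := p.map σ) (by simpa using hne)
    obtain ⟨v, hv⟩ := Word.exists_letters_eq (l := p'.map σ) (by simpa using hp₀)
    have := satisfies_iff.1 (h u (hσ u p (.refl _) hu) v (hσ v p' hpp'.symm hv))
    rwa [hu, hv, SatisfiesList.map_perm_iff] at this
  · exact fun h u hu v hv => satisfies_iff.2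
      (h _ _ (Part.letterCounts_of_mem_transversal hu) (Part.perm_of_mem_transversal hu hv))

theorem reduces_iff : V.Reduces l ↔
    ∃ p p' : List ℕ, letterCounts p = l.parts ∧ p.Perm p' ∧ p ≠ p' ∧ V.SatisfiesList p p' := by
  constructor
  · rintro ⟨u, hu, v, hv, hne, h⟩
    exact ⟨_, _, Part.letterCounts_of_mem_transversal hu, Part.perm_of_mem_transversal hu hv,
      Word.letters_injective.ne hne, satisfies_iff.1 h⟩
  · rintro ⟨p, p', hp, hpp', hne, h⟩
    obtain ⟨σ, hσ⟩ := Part.exists_map_mem_transversal hp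
    have hnil := Part.ne_nil_of_letterCounts hp
    have hp₀ : p' ≠ [] := fun h => hnil (show p.Perm [] from h ▸ hpp').eq_nil
    obtain ⟨u, hu⟩ := Word.exists_letters_eq (l := p.map σ) (by simpa using hnil)
    obtain ⟨v, hv⟩ := Word.exists_letters_eq (l := p'.map σ) (by simpa using hp₀)
    refine ⟨u, hσ u p (.refl _) hu, v, hσ v p' hpp'.symm hv, ?_, ?_⟩
    · rintro rfl
      exact hne (List.map_injective_iff.2 σ.injective (hu.symm.trans hv))
    · rwa [satisfies_iff, hu, hv, SatisfiesList.map_perm_iff]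

/-- A greedy variety that satisfies a nontrivial balanced identity satisfies all identities between
words of the same type. -/
theorem IsGreedy.satisfiesList (hV : V.IsGreedy) {p p' q q' : List ℕ} (hpp' : p.Perm p')
    (hne : p ≠ p') (h : V.SatisfiesList p p') (hq : letterCounts q = letterCounts p)
    (hqq' : q.Perm q') : V.SatisfiesList q q' := by
  obtain ⟨l, hl⟩ := Part.exists_part hpp' hne
  exact collapses_iff.1 (hV l (reduces_iff.2 ⟨p, p', hl, hpp', hne, h⟩)) q q' (hq.trans hl) hqq'

end SemigroupVariety

/-! ### Greedy varieties are cancellable -/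

namespace SemigroupVariety

variable {V W : SemigroupVariety.{u}}

theorem Satisfies.lift {u v : Word} (h : V.Satisfies (u, v)) (φ : ℕ → Word) :
    V.Satisfies (FreeSemigroup.lift φ u, FreeSemigroup.lift φ v) := by
  rw [satisfies_iff] at h ⊢
  rw [Word.letters_lift, Word.letters_lift]
  exact h.flatMap φ

theorem satisfies_var_of_mem {E : Set (Word × Word)} {e : Word × Word} (he : e ∈ E) :
    (var.{u} E).Satisfies e := fun _ _ hS => hS e he

theorem satisfies_sup {u v : Word} :
    (V ⊔ W).Satisfies (u, v) ↔ V.Satisfies (u, v) ∧ W.Satisfies (u, v) :=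
  ⟨fun h => ⟨le_iff_satisfies.1 le_sup_left u v h, le_iff_satisfies.1 le_sup_right u v h⟩,
    fun h _ _ hS => hS _ h⟩

/-- An identity holds in the meet of two varieties if and only if it can be derived by a chain of
identities each of which holds in one of them. -/
theorem reflTransGen_of_satisfies_inf {u v : Word} (h : (V ⊓ W).Satisfies (u, v)) :
    Relation.ReflTransGen (fun x y => V.Satisfies (x, y) ∨ W.Satisfies (x, y)) u v := by
  set R : Word → Word → Prop := fun x y => V.Satisfies (x, y) ∨ W.Satisfies (x, y) with hR
  have hsymm : Std.Symm R := ⟨fun x y hxy => hxy.imp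
    (fun h => satisfies_iff.2 (satisfies_iff.1 h).symm)
    (fun h => satisfies_iff.2 (satisfies_iff.1 h).symm)⟩
  have hl (z x y : Word) (hxy : R x y) : R (z * x) (z * y) := hxy.imp
    (fun h => satisfies_iff.2 ((satisfies_iff.1 h).append_left z.letters))
    (fun h => satisfies_iff.2 ((satisfies_iff.1 h).append_left z.letters))
  have hr (z x y : Word) (hxy : R x y) : R (x * z) (y * z) := hxy.imp
    (fun h => satisfies_iff.2 ((satisfies_iff.1 h).append_right z.letters))
    (fun h => satisfies_iff.2 ((satisfies_iff.1 h).append_right z.letters))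
  let c : Con Word :=
    { r := Relation.ReflTransGen R
      iseqv := ⟨fun _ => .refl, fun h => Std.Symm.symm _ _ h, .trans⟩
      mul' := fun {w x y z} h₁ h₂ =>
        (h₁.lift (· * y) (hr y)).trans (h₂.lift (x * ·) (hl x)) }
  obtain ⟨E, rfl⟩ := V.exists_eq_var
  obtain ⟨F, rfl⟩ := W.exists_eq_var
  refine rel_of_satisfies_var (E := E ∪ F) (c := c) ?_ fun S _ hS => h S
    ⟨fun e he => hS e (Or.inl he), fun e he => hS e (Or.inr he)⟩
  rintro ⟨x, y⟩ (he | he) φ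
  · exact .single (Or.inl ((satisfies_var_of_mem he).lift φ))
  · exact .single (Or.inr ((satisfies_var_of_mem he).lift φ))

/-- Greedy varieties are cancellable. -/
theorem IsGreedy.isCancellableElement {V : OC.{u}} (hV : (V : SemigroupVariety.{u}).IsGreedy) :
    IsCancellableElement V := by
  have key : ∀ Y Z : OC.{u}, V ⊔ Y = V ⊔ Z → V ⊓ Y = V ⊓ Z →
      (Z : SemigroupVariety.{u}) ≤ Y := by
    intro Y Z hsup hinf
    have hsup' : (V : SemigroupVariety.{u}) ⊔ Y = V ⊔ Z := congrArg Subtype.val hsup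
    have hinf' : (V : SemigroupVariety.{u}) ⊓ Y = V ⊓ Z := congrArg Subtype.val hinf
    refine le_iff_satisfies.2 fun u v huv => ?_
    have hperm := IsOvercommutative.perm Y.2 huv
    by_cases hred : ∃ p p' : List ℕ, p.Perm u.letters ∧ p.Perm p' ∧ p ≠ p' ∧
        (V : SemigroupVariety.{u}).SatisfiesList p p'
    · obtain ⟨p, p', hpu, hpp', hne, h⟩ := hred
      have hVuv := satisfies_iff.2
        (hV.satisfiesList hpp' hne h (letterCounts_perm hpu.symm) hperm)
      exact (satisfies_sup.1 (hsup' ▸ satisfies_sup.2 ⟨hVuv, huv⟩)).2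
    · have hchain := reflTransGen_of_satisfies_inf
        (hinf' ▸ le_iff_satisfies.1 (inf_le_right (a := (V : SemigroupVariety.{u}))) u v huv)
      have : u.letters.Perm v.letters ∧ (Z : SemigroupVariety.{u}).Satisfies (u, v) := by
        clear huv hperm
        induction hchain with
        | refl => exact ⟨.refl _, satisfies_iff.2 (.refl _ _)⟩
        | @tail x y _ hxy ih =>
          rcases hxy with hxy | hxy
          -- Every word of the chain is a rearrangement of `u`, so a nontrivial step from `V` would
          -- contradict `hred`.
          · by_cases heq : x = y
            · exact heq ▸ ih
            · exact absurd ⟨_, _, ih.1.symm, IsOvercommutative.perm V.2 hxy,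
                Word.letters_injective.ne heq, satisfies_iff.1 hxy⟩ hred
          · exact ⟨ih.1.trans (IsOvercommutative.perm Z.2 hxy),
              satisfies_iff.2 ((satisfies_iff.1 ih.2).trans (satisfies_iff.1 hxy))⟩
      exact this.2
  exact fun Y Z hsup hinf =>
    Subtype.ext (le_antisymm (key Z Y hsup.symm hinf.symm) (key Y Z hsup hinf))

end SemigroupVariety

/-! ### Varieties given by one pair of words, and a criterion for non-cancellability -/

/-- Renaming of letters is determined by its effect on any list with the same letters. -/
theorem map_eq_map_of_perm {b c : List ℕ} (hbc : b.Perm c) {f g : ℕ → ℕ}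
    (h : c.map f = c.map g) : b.map f = b.map g :=
  List.map_congr_left fun x hx => List.map_inj_left.1 h x (hbc.mem_iff.1 hx)

theorem map_eq_map_iff {b c : List ℕ} {σ τ : Equiv.Perm ℕ} :
    b.map σ = c.map τ ↔ b.map (σ.trans τ.symm) = c := by
  constructor
  · intro h
    rw [Equiv.coe_trans, ← List.map_map, h]
    simp
  · rintro rfl
    simp [Function.comp_def]

theorem length_le_length_flatMap (φ : ℕ → Word) (l : List ℕ) :
    l.length ≤ (l.flatMap fun i => (φ i).letters).length := by
  induction l with
  | nil => simp
  | cons a l ih =>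
    have : 0 < (φ a).letters.length := List.length_pos_iff.2 (φ a).letters_ne_nil
    simp only [List.flatMap_cons, List.length_append, List.length_cons]
    lia

theorem flatMap_eq_map (φ : ℕ → Word) (l : List ℕ)
    (h : (l.flatMap fun i => (φ i).letters).length ≤ l.length) :
    (l.flatMap fun i => (φ i).letters) = l.map fun i => (φ i).head := by
  induction l with
  | nil => rfl
  | cons a l ih =>
    have h₁ := length_le_length_flatMap φ l
    simp only [List.flatMap_cons, List.length_append, List.length_cons] at h
    have h₂ : (φ a).letters.length = (φ a).tail.length + 1 := rfl
    have h₃ : (φ a).tail = [] := List.length_eq_zero_iff.1 (by lia)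
    rw [List.flatMap_cons, ih (by lia), List.map_cons, Word.letters, h₃]
    rfl

theorem toFinset_map (f : ℕ → ℕ) (l : List ℕ) : (l.map f).toFinset = l.toFinset.image f := by
  ext
  simp

/-- A list is above `b` if it is longer, or has the same length and fewer letters. -/
def IsAbove (b l : List ℕ) : Prop :=
  b.length < l.length ∨ b.length = l.length ∧ l.toFinset.card < b.toFinset.card

/-- The consequences of the identity `b ≈ c` up to all balanced identities above `b`. -/
def PairRel (b c l l' : List ℕ) : Prop :=
  l.Perm l' ∧ (IsAbove b l ∨ l = l' ∨
    ∃ σ : Equiv.Perm ℕ, (l = b.map σ ∧ l' = c.map σ) ∨ (l = c.map σ ∧ l' = b.map σ))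

section PairRel

variable {b c l l' l'' : List ℕ}

theorem IsAbove.perm (h : IsAbove b l) (hl : l.Perm l') : IsAbove b l' := by
  rwa [IsAbove, ← hl.length_eq, ← List.toFinset_eq_of_perm _ _ hl]

theorem isAbove_congr {b' : List ℕ} (hb : b.Perm b') : IsAbove b l ↔ IsAbove b' l := by
  rw [IsAbove, IsAbove, hb.length_eq, List.toFinset_eq_of_perm _ _ hb]

theorem not_isAbove_map (σ : Equiv.Perm ℕ) (hl : l.Perm b) : ¬ IsAbove b (l.map σ) := by
  simp [IsAbove, toFinset_map, Finset.card_image_of_injective _ σ.injective, hl.length_eq, List.toFinset_eq_of_perm _ _ hl]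

theorem IsAbove.flatMap (h : IsAbove b l) (φ : ℕ → Word) :
    IsAbove b (l.flatMap fun i => (φ i).letters) := by
  have h₁ := length_le_length_flatMap φ l
  rcases h with h | ⟨h, h'⟩
  · exact Or.inl (by lia)
  · by_cases h₂ : (l.flatMap fun i => (φ i).letters).length ≤ l.length
    · rw [flatMap_eq_map φ l h₂]
      refine Or.inr ⟨by simpa using h, lt_of_le_of_lt ?_ h'⟩
      rw [toFinset_map]
      exact Finset.card_image_le
    · exact Or.inl (by lia)

/-- A substitution into a word of the type of `b` is a renaming or leads above `b`. -/
theorem isAbove_flatMap_or (hlen : l.length = b.length)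
    (hcard : l.toFinset.card = b.toFinset.card) (φ : ℕ → Word) :
    IsAbove b (l.flatMap fun i => (φ i).letters) ∨
      ∃ τ : Equiv.Perm ℕ, ∀ l' : List ℕ, l'.Perm l → (l'.flatMap fun i => (φ i).letters) = l'.map τ := by
  by_cases h : (l.flatMap fun i => (φ i).letters).length ≤ l.length
  · have hmap := flatMap_eq_map φ l h
    by_cases hinj : Set.InjOn (fun i => (φ i).head) (l.toFinset : Set ℕ)
    · obtain ⟨τ, hτ⟩ := exists_perm_extending _ _ hinj
      refine Or.inr ⟨τ, fun l' hl' => ?_⟩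
      rw [flatMap_eq_map φ l' (by rwa [(hl'.flatMap_right _).length_eq, hl'.length_eq])]
      exact List.map_congr_left fun x hx =>
        (hτ x (List.mem_toFinset.2 (hl'.mem_iff.1 hx))).symm
    · refine Or.inl (Or.inr ⟨by rw [hmap, List.length_map, hlen], ?_⟩)
      rw [hmap, toFinset_map, ← hcard]
      exact lt_of_le_of_ne Finset.card_image_le fun h => hinj (Finset.card_image_iff.1 h)
  · exact Or.inl (Or.inl (by lia))

theorem card_toFinset_map (σ : Equiv.Perm ℕ) (l : List ℕ) :
    (l.map σ).toFinset.card = l.toFinset.card := by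
  rw [toFinset_map, Finset.card_image_of_injective _ σ.injective]

theorem PairRel.refl (b c l : List ℕ) : PairRel b c l l := ⟨.refl _, Or.inr (Or.inl rfl)⟩

theorem PairRel.symm (h : PairRel b c l l') : PairRel b c l' l := by
  obtain ⟨hp, h | rfl | ⟨σ, h | h⟩⟩ := h
  · exact ⟨hp.symm, Or.inl (h.perm hp)⟩
  · exact .refl _ _ _
  · exact ⟨hp.symm, Or.inr (Or.inr ⟨σ, Or.inr h.symm⟩)⟩
  · exact ⟨hp.symm, Or.inr (Or.inr ⟨σ, Or.inl h.symm⟩)⟩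

theorem PairRel.trans (hbc : b.Perm c) (hinv : ∀ σ : Equiv.Perm ℕ, c.map σ = b → b.map σ = c)
    (h : PairRel b c l l') (h' : PairRel b c l' l'') : PairRel b c l l'' := by
  obtain ⟨hp, h₁⟩ := h
  obtain ⟨hp', h₂⟩ := h'
  refine ⟨hp.trans hp', ?_⟩
  rcases h₁ with h₁ | rfl | ⟨σ, h₁⟩
  · exact Or.inl h₁
  · exact h₂
  rcases h₂ with h₂ | rfl | ⟨τ, h₂⟩
  · exact Or.inl (h₂.perm hp.symm)
  · exact Or.inr (Or.inr ⟨σ, h₁⟩)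
  -- Two renamed steps in a row lead back to the start: `hinv` makes any renaming that sends `c` to
  -- `b` exchange the two words.
  refine Or.inr (Or.inl ?_)
  rcases h₁ with ⟨rfl, rfl⟩ | ⟨rfl, rfl⟩ <;> rcases h₂ with ⟨h₂, rfl⟩ | ⟨h₂, rfl⟩
  · exact map_eq_map_iff.2 (hinv _ (map_eq_map_iff.1 h₂))
  · exact map_eq_map_of_perm hbc h₂
  · exact map_eq_map_of_perm hbc.symm h₂
  · exact (map_eq_map_iff.2 (hinv _ (map_eq_map_iff.1 h₂.symm))).symm

theorem PairRel.length_eq_or (hbc : b.Perm c) (h : PairRel b c l l') :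
    IsAbove b l ∨ l = l' ∨ l.length = b.length ∧ l.toFinset.card = b.toFinset.card := by
  obtain ⟨hp, h | h | ⟨σ, ⟨rfl, -⟩ | ⟨rfl, -⟩⟩⟩ := h
  · exact Or.inl h
  · exact Or.inr (Or.inl h)
  · exact Or.inr (Or.inr ⟨by simp, card_toFinset_map _ _⟩)
  · refine Or.inr (Or.inr ⟨by simp [hbc.length_eq], ?_⟩)
    rw [card_toFinset_map, List.toFinset_eq_of_perm _ _ hbc]

theorem PairRel.append (hbc : b.Perm c) (h : PairRel b c l l') (x y : List ℕ) :
    PairRel b c (x ++ l ++ y) (x ++ l' ++ y) := by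
  have hp := h.1
  by_cases hxy : x = [] ∧ y = []
  · obtain ⟨rfl, rfl⟩ := hxy
    simpa using h
  -- A nonempty context makes a word at least as long as `b` strictly longer, so the result is above
  -- `b`.
  have hlt : l.length < (x ++ l ++ y).length := by
    have h₁ : 0 < x.length ∨ 0 < y.length := by
      rw [List.length_pos_iff, List.length_pos_iff]
      tauto
    simp only [List.length_append]
    lia
  refine ⟨(hp.append_left x).append_right y, ?_⟩
  rcases h.length_eq_or hbc with (h | h) | rfl | h
  · exact Or.inl (Or.inl (by lia))
  · exact Or.inl (Or.inl (by lia))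
  · exact Or.inr (Or.inl rfl)
  · exact Or.inl (Or.inl (by lia))

theorem PairRel.flatMap (hbc : b.Perm c) (h : PairRel b c l l') (φ : ℕ → Word) :
    PairRel b c (l.flatMap fun i => (φ i).letters) (l'.flatMap fun i => (φ i).letters) := by
  have hp := h.1
  refine ⟨hp.flatMap_right _, ?_⟩
  rcases h.length_eq_or hbc with h₁ | rfl | ⟨h₁, h₂⟩
  · exact Or.inl (h₁.flatMap φ)
  · exact Or.inr (Or.inl rfl)
  · rcases isAbove_flatMap_or h₁ h₂ φ with h₃ | ⟨τ, hτ⟩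
    · exact Or.inl h₃
    rw [hτ l (.refl _), hτ l' hp.symm]
    obtain ⟨-, h | rfl | ⟨σ, h⟩⟩ := h
    · rcases h with h | ⟨-, h⟩
      · lia
      · lia
    · exact Or.inr (Or.inl rfl)
    · refine Or.inr (Or.inr ⟨σ.trans τ, ?_⟩)
      rcases h with ⟨rfl, rfl⟩ | ⟨rfl, rfl⟩
      · left; simp
      · right; simp

end PairRel

namespace SemigroupVariety

variable {b c b' c' : List ℕ}

/-- The variety given by the identity `b ≈ c` and all balanced identities above `b`. -/
def pairVariety (b c : List ℕ) : SemigroupVariety.{u} :=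
  var {e | PairRel b c e.1.letters e.2.letters}

theorem satisfies_pairVariety (hbc : b.Perm c)
    (hinv : ∀ σ : Equiv.Perm ℕ, c.map σ = b → b.map σ = c) {u v : Word} :
    (pairVariety.{u} b c).Satisfies (u, v) ↔ PairRel b c u.letters v.letters := by
  refine ⟨fun h => ?_, fun h S _ hS => hS (u, v) h⟩
  refine rel_of_satisfies_var (c := Word.conOfList (PairRel b c)
    ⟨.refl b c, .symm, .trans hbc hinv⟩ fun x y l l' h => h.append hbc x y) (fun e he φ => ?_) h
  change PairRel b c (Word.letters _) (Word.letters _)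
  rw [Word.letters_lift, Word.letters_lift]
  exact PairRel.flatMap hbc he φ

theorem isOvercommutative_pairVariety : (pairVariety.{u} b c).IsOvercommutative :=
  isOvercommutative_var fun _ he => he.1

/-- A criterion for an overcommutative variety to be non-cancellable. -/
theorem not_isCancellableElement {V : OC.{u}} (hb : b.Perm b') (hc : c.Perm c') (hbc : b.Perm c)
    (hVb : (V : SemigroupVariety.{u}).SatisfiesList b b')
    (hVc : (V : SemigroupVariety.{u}).SatisfiesList c c')
    (hVbc : ¬ (V : SemigroupVariety.{u}).SatisfiesList b c)
    (hinv : ∀ σ : Equiv.Perm ℕ, c.map σ = b → b.map σ = c)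
    (hinv' : ∀ σ : Equiv.Perm ℕ, c'.map σ = b' → b'.map σ = c')
    (hne : ¬ ∃ σ : Equiv.Perm ℕ,
      (b = b'.map σ ∧ c = c'.map σ) ∨ (b = c'.map σ ∧ c = b'.map σ)) :
    ¬ IsCancellableElement V := by
  have hVbc' : ¬ (V : SemigroupVariety.{u}).SatisfiesList b' c' :=
    fun h => hVbc ((hVb.trans h).trans hVc.symm)
  have hbc' : b'.Perm c' := (hb.symm.trans hbc).trans hc
  -- `V` satisfies no renaming of `b ≈ c`, so beyond the trivial identities only those above `b`
  -- survive in the join, and being above `b` is the same as being above `b'`.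
  have sup_le {b c b' c' : List ℕ} (hb : b.Perm b') (hbc : b.Perm c) (hbc' : b'.Perm c')
      (hVbc : ¬ (V : SemigroupVariety.{u}).SatisfiesList b c)
      (hinv : ∀ σ : Equiv.Perm ℕ, c.map σ = b → b.map σ = c)
      (hinv' : ∀ σ : Equiv.Perm ℕ, c'.map σ = b' → b'.map σ = c') :
      (V : SemigroupVariety.{u}) ⊔ pairVariety b' c' ≤
        (V : SemigroupVariety.{u}) ⊔ pairVariety b c := by
    refine le_iff_satisfies.2 fun u v h => ?_
    rw [satisfies_sup, satisfies_pairVariety hbc hinv] at h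
    rw [satisfies_sup, satisfies_pairVariety hbc' hinv']
    obtain ⟨hV, hp, h | h | ⟨σ, ⟨h₁, h₂⟩ | ⟨h₁, h₂⟩⟩⟩ := h
    · exact ⟨hV, hp, Or.inl ((isAbove_congr hb).1 h)⟩
    · exact ⟨hV, hp, Or.inr (Or.inl h)⟩
    · rw [satisfies_iff, h₁, h₂, SatisfiesList.map_perm_iff] at hV
      exact absurd hV hVbc
    · rw [satisfies_iff, h₁, h₂, SatisfiesList.map_perm_iff] at hV
      exact absurd hV.symm hVbc
  -- Modulo `V`, the identities `b ≈ c` and `b' ≈ c'` imply each other through `b ≈ b'` and `c ≈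
  -- c'`.
  have inf_le {b c b' c' : List ℕ} (hb : b.Perm b') (hbc : b.Perm c) (hbc' : b'.Perm c')
      (hVb : (V : SemigroupVariety.{u}).SatisfiesList b b')
      (hVc : (V : SemigroupVariety.{u}).SatisfiesList c c')
      (hinv : ∀ σ : Equiv.Perm ℕ, c.map σ = b → b.map σ = c)
      (hinv' : ∀ σ : Equiv.Perm ℕ, c'.map σ = b' → b'.map σ = c') (hnil : b ≠ []) :
      (V : SemigroupVariety.{u}) ⊓ pairVariety b c ≤
        (V : SemigroupVariety.{u}) ⊓ pairVariety b' c' := by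
    refine le_inf inf_le_left (le_iff_satisfies.2 fun u v h => ?_)
    have hbc_list : ((V : SemigroupVariety.{u}) ⊓ pairVariety b c).SatisfiesList b c := by
      obtain ⟨x, rfl⟩ := Word.exists_letters_eq hnil
      obtain ⟨y, rfl⟩ := Word.exists_letters_eq (l := c)
        fun h => hnil (show x.letters.Perm [] from h ▸ hbc).eq_nil
      refine SatisfiesList.mono (satisfies_iff.1 ?_) (inf_le_right (b := pairVariety _ _))
      rw [satisfies_pairVariety hbc hinv]
      exact ⟨hbc, Or.inr (Or.inr ⟨1, Or.inl (by simp)⟩)⟩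
    have hlist : ((V : SemigroupVariety.{u}) ⊓ pairVariety b c).SatisfiesList b' c' :=
      ((hVb.symm.mono inf_le_left).trans hbc_list).trans (hVc.mono inf_le_left)
    rw [satisfies_pairVariety hbc' hinv'] at h
    obtain ⟨hp, h | h | ⟨σ, ⟨h₁, h₂⟩ | ⟨h₁, h₂⟩⟩⟩ := h
    · refine le_iff_satisfies.1 (inf_le_right (b := pairVariety b c)) u v ?_
      rw [satisfies_pairVariety hbc hinv]
      exact ⟨hp, Or.inl ((isAbove_congr hb).2 h)⟩
    · rw [satisfies_iff, h]
      exact .refl _ _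
    · rw [satisfies_iff, h₁, h₂]
      exact hlist.map σ
    · rw [satisfies_iff, h₁, h₂]
      exact hlist.symm.map σ
  have hnil : b ≠ [] := by
    rintro rfl
    obtain rfl := hbc.nil_eq
    exact hVbc (.refl _ _)
  have hnil' : b' ≠ [] := fun h => hnil (show b.Perm [] from h ▸ hb).eq_nil
  intro hV
  have heq := hV ⟨pairVariety b c, isOvercommutative_pairVariety⟩
    ⟨pairVariety b' c', isOvercommutative_pairVariety⟩
    (Subtype.ext (le_antisymm (sup_le hb.symm hbc' hbc hVbc' hinv' hinv)
      (sup_le hb hbc hbc' hVbc hinv hinv')))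
    (Subtype.ext (le_antisymm (inf_le hb hbc hbc' hVb hVc hinv hinv' hnil)
      (inf_le hb.symm hbc' hbc hVb.symm hVc.symm hinv' hinv hnil')))
  have heq' : pairVariety.{u} b c = pairVariety b' c' := congrArg Subtype.val heq
  obtain ⟨x, rfl⟩ := Word.exists_letters_eq hnil
  obtain ⟨y, rfl⟩ := Word.exists_letters_eq (l := c)
    fun h => hnil (show x.letters.Perm [] from h ▸ hbc).eq_nil
  have h₁ : (pairVariety.{u} x.letters y.letters).Satisfies (x, y) :=
    (satisfies_pairVariety hbc hinv).2 ⟨hbc, Or.inr (Or.inr ⟨1, Or.inl (by simp)⟩)⟩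
  rw [heq', satisfies_pairVariety hbc' hinv'] at h₁
  obtain ⟨-, h | h | h⟩ := h₁
  · have := not_isAbove_map 1 hb
    simp only [Equiv.Perm.coe_one, List.map_id] at this
    exact this h
  · exact hVbc (h ▸ .refl _ _)
  · exact hne h

end SemigroupVariety

/-! ### Cancellable varieties are greedy -/

/-- If a relation `R` contains a nontrivial pair and is inherited by all elements that are not
equivalent to the members of the pair, and there are at least three classes, then it is total. -/
theorem rel_total_of_three_classes {α : Type*} {M : α → Prop} {R P : α → α → Prop}
    (hRs : ∀ x y, R x y → R y x) (hRt : ∀ x y z, R x y → R y z → R x z)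
    (hPr : ∀ x, P x x) (hPs : ∀ x y, P x y → P y x) (hPt : ∀ x y z, P x y → P y z → P x z)
    {d₁ d₂ d₃ : α} (h₁ : M d₁) (h₂ : M d₂) (h₃ : M d₃)
    (h₁₂ : ¬ P d₁ d₂) (h₁₃ : ¬ P d₁ d₃) (h₂₃ : ¬ P d₂ d₃)
    (hF : ∀ a b c, M a → M b → M c → a ≠ b → R a b → ¬ P c a → ¬ P c b → R a c)
    {a b : α} (ha : M a) (hb : M b) (hab : a ≠ b) (hR : R a b) (w : α) (hw : M w) : R a w := by
  have avoid (x y : α) : ∃ c, M c ∧ ¬ P c x ∧ ¬ P c y := by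
    by_contra hcon
    push Not at hcon
    have k₁ := hcon d₁ h₁
    have k₂ := hcon d₂ h₂
    have k₃ := hcon d₃ h₃
    have join (d e z : α) (hd : P d z) (he : P e z) : P d e := hPt _ _ _ hd (hPs _ _ he)
    by_cases m₁ : P d₁ x
    · by_cases m₂ : P d₂ x
      · exact h₁₂ (join _ _ _ m₁ m₂)
      by_cases m₃ : P d₃ x
      · exact h₁₃ (join _ _ _ m₁ m₃)
      exact h₂₃ (join _ _ _ (k₂ m₂) (k₃ m₃))
    · by_cases m₂ : P d₂ x
      · by_cases m₃ : P d₃ x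
        · exact h₂₃ (join _ _ _ m₂ m₃)
        exact h₁₃ (join _ _ _ (k₁ m₁) (k₃ m₃))
      exact h₁₂ (join _ _ _ (k₁ m₁) (k₂ m₂))
  have ne_of {x y : α} (h : ¬ P x y) : x ≠ y := fun hxy => h (hxy ▸ hPr x)
  -- The elements `a`, `c`, `d` will be related by `R` and lie in three different classes. Any `w`
  -- avoids the classes of two of them, so `hF` applies to that pair.
  obtain ⟨c, hc, hca, hcb⟩ := avoid a b
  have hac := hF a b c ha hb hc hab hR hca hcb
  obtain ⟨d, hd, hda, hdc⟩ := avoid a c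
  have had := hF a c d ha hc hd (ne_of hca).symm hac hda hdc
  by_cases hwa : P w a
  · have hwc : ¬ P w c := fun h => hca (hPt _ _ _ (hPs _ _ h) hwa)
    have hwd : ¬ P w d := fun h => hda (hPt _ _ _ (hPs _ _ h) hwa)
    exact hRt _ _ _ hac (hF c d w hc hd hw (ne_of hdc).symm
      (hRt _ _ _ (hRs _ _ hac) had) hwc hwd)
  · by_cases hwc : P w c
    · exact hF a d w ha hd hw (ne_of hda).symm had hwa
        fun h => hdc (hPt _ _ _ (hPs _ _ h) hwc)
    · exact hF a c w ha hc hw (ne_of hca).symm hac hwa hwc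

theorem map_swap_perm {p : List ℕ} (hp : p.Nodup) {x y : ℕ} (hx : x ∈ p) (hy : y ∈ p) :
    (p.map (Equiv.swap x y)).Perm p := by
  refine (List.perm_ext_iff_of_nodup (hp.map (Equiv.injective _)) hp).2 fun z => ?_
  rw [List.mem_map]
  have h : ∀ z ∈ p, Equiv.swap x y z ∈ p := fun z hz => by
    rw [Equiv.swap_apply_def]
    split_ifs <;> assumption
  exact ⟨fun ⟨a, ha, h'⟩ => h' ▸ h a ha, fun hz => ⟨_, h z hz, by simp⟩⟩

theorem exists_map_eq_of_perm {p p' : List ℕ} (hp : p.Nodup) (h : p.Perm p') :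
    ∃ σ : Equiv.Perm ℕ, p.map σ = p' := by
  have hlen := h.length_eq
  have hp' : p'.Nodup := h.nodup_iff.1 hp
  obtain ⟨σ, hσ⟩ := exists_perm_extending p.toFinset (fun x => p'.getD (p.idxOf x) 0) (by
    intro x hx y hy hxy
    have hx' : x ∈ p := by simpa using hx
    have hy' : y ∈ p := by simpa using hy
    have h₁ := List.idxOf_lt_length_of_mem hx'
    have h₂ := List.idxOf_lt_length_of_mem hy'
    simp only at hxy
    rw [List.getD_eq_getElem _ _ (hlen ▸ h₁), List.getD_eq_getElem _ _ (hlen ▸ h₂)] at hxy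
    exact (List.idxOf_inj hx').1 (hp'.getElem_inj_iff.1 hxy))
  refine ⟨σ, List.ext_getElem (by simpa using hlen) fun i h₁ h₂ => ?_⟩
  rw [List.getElem_map, hσ _ (by simp), hp.idxOf_getElem, List.getD_eq_getElem _ _ h₂]

theorem apply_mem_pair_of_commute {σ : Equiv.Perm ℕ} {x y : ℕ} (hxy : x ≠ y)
    (h : σ (Equiv.swap x y x) = Equiv.swap x y (σ x)) : σ x = x ∨ σ x = y := by
  by_contra hcon
  push Not at hcon
  rw [Equiv.swap_apply_of_ne_of_ne hcon.1 hcon.2, Equiv.swap_apply_left] at h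
  exact hxy (σ.injective h.symm)

namespace SemigroupVariety

variable {V : OC.{u}}

/-- The criterion is applied to the pairs `b ≈ c` and `a ≈ c`. Both inversion conditions are
vacuous, and a renaming between the pairs would either fix all letters, giving `a = b`, or send `c`
to `b`. -/
theorem satisfiesList_of_not_map (hV : IsCancellableElement V) {a b c : List ℕ} (hab : a.Perm b)
    (hac : a.Perm c) (hne : a ≠ b) (h : (V : SemigroupVariety.{u}).SatisfiesList a b)
    (hca : ¬ ∃ σ : Equiv.Perm ℕ, c.map σ = a) (hcb : ¬ ∃ σ : Equiv.Perm ℕ, c.map σ = b) :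
    (V : SemigroupVariety.{u}).SatisfiesList a c := by
  by_contra hcon
  refine not_isCancellableElement hab.symm (.refl c) (hab.symm.trans hac) h.symm (.refl _ c)
    (fun h' => hcon (h.trans h')) (fun σ hσ => absurd ⟨σ, hσ⟩ hcb)
    (fun σ hσ => absurd ⟨σ, hσ⟩ hca) ?_ hV
  rintro ⟨σ, ⟨h₁, h₂⟩ | ⟨h₁, -⟩⟩
  · refine hne ?_
    have h₃ : c.map σ = c.map id := by rw [List.map_id, ← h₂]
    rw [h₁, map_eq_map_of_perm hac h₃, List.map_id]
  · exact hcb ⟨σ, h₁.symm⟩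

/-- A cancellable variety that satisfies a nontrivial identity between words with a repeated letter
satisfies all identities between rearrangements of these words. -/
theorem satisfiesList_of_not_nodup (hV : IsCancellableElement V) {p p' d : List ℕ}
    (hp : ¬ p.Nodup) (hpp' : p.Perm p') (hne : p ≠ p')
    (h : (V : SemigroupVariety.{u}).SatisfiesList p p') (hd : p.Perm d) :
    (V : SemigroupVariety.{u}).SatisfiesList p d := by
  obtain ⟨x, hx⟩ : ∃ x, 2 ≤ p.count x := by
    by_contra hcon
    push Not at hcon
    exact hp (List.nodup_iff_count_le_one.2 fun x => Nat.lt_succ_iff.1 (hcon x))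
  obtain ⟨y, hy, hyx⟩ : ∃ y ∈ p, y ≠ x := by
    by_contra hcon
    push Not at hcon
    refine hne ?_
    rw [List.eq_replicate_of_mem hcon,
      List.eq_replicate_of_mem fun b hb => hcon b (hpp'.mem_iff.2 hb), hpp'.length_eq]
  obtain ⟨r, hr⟩ : ∃ r, p.Perm (x :: x :: y :: r) := by
    have h₁ : (List.replicate 2 x).Sublist p := List.replicate_sublist_iff.2 hx
    obtain ⟨t, ht⟩ := h₁.exists_perm_append
    have hyt : y ∈ t := by
      have := ht.mem_iff.1 hy
      simpa [hyx] using this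
    obtain ⟨r, hr⟩ : ∃ r, t.Perm (y :: r) := ⟨_, List.perm_cons_erase hyt⟩
    exact ⟨r, ht.trans (hr.append_left _)⟩
  -- The patterns `xxy`, `xyx` and `yxx` at the beginning are preserved by renaming, so these
  -- rearrangements represent three classes.
  have h₂ : (x :: x :: y :: r).Perm (x :: y :: x :: r) := (List.Perm.swap _ _ _).cons _
  have h₃ : (x :: y :: x :: r).Perm (y :: x :: x :: r) := List.Perm.swap _ _ _
  refine rel_total_of_three_classes (M := fun w => p.Perm w)
    (R := fun l l' => (V : SemigroupVariety.{u}).SatisfiesList l l')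
    (P := fun l l' => ∃ σ : Equiv.Perm ℕ, l.map σ = l') (fun _ _ h => h.symm)
    (fun _ _ _ h h' => h.trans h') (fun l => ⟨1, by simp⟩) ?_ ?_ hr (hr.trans h₂)
    ((hr.trans h₂).trans h₃) ?_ ?_ ?_
    (fun a b c ha hb hc hne h => satisfiesList_of_not_map hV (ha.symm.trans hb) (ha.symm.trans hc)
      hne h) (.refl p) hpp' hne h d hd
  · rintro l _ ⟨σ, rfl⟩
    exact ⟨σ.symm, by simp⟩
  · rintro l _ _ ⟨σ, rfl⟩ ⟨τ, rfl⟩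
    exact ⟨σ.trans τ, by simp⟩
  · rintro ⟨σ, hσ⟩
    simp only [List.map_cons, List.cons.injEq] at hσ
    exact hyx (hσ.2.1.symm.trans hσ.1)
  · rintro ⟨σ, hσ⟩
    simp only [List.map_cons, List.cons.injEq] at hσ
    exact hyx (hσ.1.symm.trans hσ.2.1)
  · rintro ⟨σ, hσ⟩
    simp only [List.map_cons, List.cons.injEq] at hσ
    exact hyx (hσ.1.symm.trans hσ.2.2.1)

/-- The criterion compares the pair formed by `p` and its transposed word with the image of that
pair under `σ`, both words of each pair being transposed by the same swap on values. If a renaming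
connects the pairs, `σ` commutes with the swap on `p`. -/
theorem satisfiesList_map_swap_or_commute (hV : IsCancellableElement V) {p : List ℕ}
    (hp : p.Nodup) {σ : Equiv.Perm ℕ} (hσ : (p.map σ).Perm p)
    (h : (V : SemigroupVariety.{u}).SatisfiesList p (p.map σ)) {x y : ℕ} (hx : x ∈ p)
    (hy : y ∈ p) : (V : SemigroupVariety.{u}).SatisfiesList p (p.map (Equiv.swap x y)) ∨
      ∀ z ∈ p, σ (Equiv.swap x y z) = Equiv.swap x y (σ z) := by
  by_contra hcon
  rw [not_or] at hcon
  obtain ⟨h₁, h₂⟩ := hcon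
  have hsw := map_swap_perm hp hx hy
  have hsw' := map_swap_perm (hσ.nodup_iff.2 hp) (hσ.mem_iff.2 hx) (hσ.mem_iff.2 hy)
  have inv {q : List ℕ} (hq : (q.map (Equiv.swap x y)).Perm q) (τ : Equiv.Perm ℕ)
      (hτ : q.map τ = q.map (Equiv.swap x y)) : (q.map (Equiv.swap x y)).map τ = q := by
    rw [map_eq_map_of_perm hq hτ]
    simp [Function.comp_def]
  have hmem {z : ℕ} (hz : z ∈ p) : Equiv.swap x y z ∈ p :=
    hsw.mem_iff.1 (List.mem_map_of_mem hz)
  refine not_isCancellableElement (V := V) (b := (p.map σ).map (Equiv.swap x y)) (c := p.map σ)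
    (b' := p.map (Equiv.swap x y)) (c' := p) (hσ.map _) hσ hsw' (h.symm.map _) h.symm
    (fun h' => h₁ (((h.trans h'.symm).trans (h.symm.map _)))) (inv hsw') (inv hsw) ?_ hV
  rintro ⟨τ, ⟨k₁, k₂⟩ | ⟨k₁, k₂⟩⟩
  · refine h₂ fun z hz => ?_
    rw [List.map_map, List.map_map, List.map_inj_left] at k₁
    have k₃ := List.map_inj_left.1 k₂
    rw [k₃ _ (hmem hz)]
    exact (k₁ z hz).symm
  · refine h₂ fun z hz => ?_
    rw [List.map_map, List.map_inj_left] at k₁ k₂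
    rw [k₂ _ (hmem hz), Function.comp_apply, Equiv.swap_apply_self]
    exact (k₁ z hz).symm

theorem satisfiesList_of_forall_swap {V : SemigroupVariety.{u}} {p d : List ℕ} (hp : p.Nodup)
    (h : ∀ x ∈ p, ∀ y ∈ p, V.SatisfiesList p (p.map (Equiv.swap x y))) (hd : p.Perm d) :
    V.SatisfiesList p d := by
  obtain ⟨δ, rfl⟩ := exists_map_eq_of_perm hp hd
  -- The permutation `δ` is built up by transpositions, correcting one further letter each time.
  have key : ∀ s : Finset ℕ, s ⊆ p.toFinset → ∃ τ : Equiv.Perm ℕ, (p.map τ).Perm p ∧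
      V.SatisfiesList p (p.map τ) ∧ ∀ z ∈ s, τ z = δ z := by
    intro s
    induction s using Finset.induction_on with
    | empty => exact fun _ => ⟨1, by simp, by simpa using SatisfiesList.refl V p, by simp⟩
    | insert a s ha ih =>
      intro hs
      rw [Finset.insert_subset_iff, List.mem_toFinset] at hs
      obtain ⟨τ, h₁, h₂, h₃⟩ := ih hs.2
      have hτa : τ a ∈ p := h₁.mem_iff.1 (List.mem_map_of_mem hs.1)
      have hδa : δ a ∈ p := hd.mem_iff.2 (List.mem_map_of_mem hs.1)
      refine ⟨τ.trans (Equiv.swap (τ a) (δ a)), ?_, ?_, fun z hz => ?_⟩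
      · rw [Equiv.coe_trans, ← List.map_map]
        exact (h₁.map _).trans (map_swap_perm hp hτa hδa)
      · rw [Equiv.coe_trans, ← List.map_map]
        exact (h _ hτa _ hδa).trans (h₂.map _)
      · rw [Equiv.trans_apply]
        rcases Finset.mem_insert.1 hz with rfl | hz'
        · simp
        · have hza : z ≠ a := fun h => ha (h ▸ hz')
          rw [Equiv.swap_apply_of_ne_of_ne (τ.injective.ne hza), h₃ z hz']
          rw [h₃ z hz']
          exact δ.injective.ne hza
  obtain ⟨τ, -, h₂, h₃⟩ := key _ subset_rfl
  rwa [List.map_congr_left fun z hz => h₃ z (List.mem_toFinset.2 hz)] at h₂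

/-- A cancellable variety that satisfies a nontrivial identity between words without repeated
letters satisfies all identities between rearrangements of these words. -/
theorem satisfiesList_of_nodup (hV : IsCancellableElement V) {p p' d : List ℕ}
    (hp : p.Nodup) (hpp' : p.Perm p') (hne : p ≠ p')
    (h : (V : SemigroupVariety.{u}).SatisfiesList p p') (hd : p.Perm d) :
    (V : SemigroupVariety.{u}).SatisfiesList p d := by
  by_contra hcon
  obtain ⟨x, hx, y, hy, hxy⟩ : ∃ x ∈ p, ∃ y ∈ p,
      ¬ (V : SemigroupVariety.{u}).SatisfiesList p (p.map (Equiv.swap x y)) := by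
    by_contra hall
    push Not at hall
    exact hcon (satisfiesList_of_forall_swap hp hall hd)
  obtain ⟨σ, rfl⟩ := exists_map_eq_of_perm hp hpp'
  have hne_of {a b : ℕ} (hab : ¬ (V : SemigroupVariety.{u}).SatisfiesList p
      (p.map (Equiv.swap a b))) : a ≠ b := by
    rintro rfl
    exact hab (by simpa using SatisfiesList.refl _ p)
  have hpair {a b : ℕ} (ha : a ∈ p) (hb : b ∈ p)
      (hab : ¬ (V : SemigroupVariety.{u}).SatisfiesList p (p.map (Equiv.swap a b))) :
      (σ a = a ∨ σ a = b) ∧ (σ b = b ∨ σ b = a) := by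
    have hc := (satisfiesList_map_swap_or_commute hV hp hpp'.symm h ha hb).resolve_left hab
    refine ⟨apply_mem_pair_of_commute (hne_of hab) (hc a ha),
      apply_mem_pair_of_commute (hne_of hab).symm ?_⟩
    rw [Equiv.swap_comm]
    exact hc b hb
  -- If the swap of `a` and `z` held, it would have to commute with the failing swap of `a` and `b`,
  -- which it does not.
  have hthird {z a b : ℕ} (hz : z ∈ p) (ha : a ∈ p) (hb : b ∈ p) (hza : z ≠ a) (hzb : z ≠ b)
      (hab : ¬ (V : SemigroupVariety.{u}).SatisfiesList p (p.map (Equiv.swap a b))) :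
      ¬ (V : SemigroupVariety.{u}).SatisfiesList p (p.map (Equiv.swap a z)) := by
    intro h'
    have hc := (satisfiesList_map_swap_or_commute hV hp (map_swap_perm hp ha hz) h'
      ha hb).resolve_left hab a ha
    rw [Equiv.swap_apply_left, Equiv.swap_apply_left,
      Equiv.swap_apply_of_ne_of_ne (hne_of hab).symm hzb.symm,
      Equiv.swap_apply_of_ne_of_ne hza hzb] at hc
    exact hzb hc.symm
  have hyx : ¬ (V : SemigroupVariety.{u}).SatisfiesList p (p.map (Equiv.swap y x)) := by
    rwa [Equiv.swap_comm]
  obtain ⟨hσx, hσy⟩ := hpair hx hy hxy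
  have hinj : σ x ≠ σ y := σ.injective.ne (hne_of hxy)
  -- With a third letter, `σ` preserves both `{x, y}` and `{x, z}`, so it fixes `x`, and then every
  -- letter of `p`. With only two letters, `σ` is on `p` either the identity or the failing swap.
  by_cases hex : ∃ z ∈ p, z ≠ x ∧ z ≠ y
  · obtain ⟨z, hz, hzx, hzy⟩ := hex
    have h₁ := (hpair hx hz (hthird hz hx hy hzx hzy hxy)).1
    have h₂ := hne_of hxy
    have hfix : ∀ w ∈ p, σ w = w := by
      intro w hw
      have hx' : σ x = x := by grind
      have hy' : σ y = y := by grind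
      by_cases hwx : w = x
      · rw [hwx, hx']
      by_cases hwy : w = y
      · rw [hwy, hy']
      have h₃ := (hpair hx hw (hthird hw hx hy hwx hwy hxy)).2
      have h₄ : σ w ≠ σ x := σ.injective.ne hwx
      grind
    exact hne ((List.map_congr_left hfix).trans (List.map_id p)).symm
  · push Not at hex
    rcases hσx with hσx | hσx
    · refine hne ((List.map_congr_left (g := id) fun w hw => ?_).trans (List.map_id p)).symm
      by_cases hwx : w = x
      · rw [hwx, hσx, id]
      · rw [hex w hw hwx, id]
        grind
    · refine hxy ?_
      rwa [List.map_congr_left (g := Equiv.swap x y) fun w hw => ?_] at h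
      by_cases hwx : w = x
      · rw [hwx, hσx, Equiv.swap_apply_left]
      · rw [hex w hw hwx, Equiv.swap_apply_right]
        grind

/-- Cancellable varieties are greedy. -/
theorem isGreedy_of_isCancellableElement (hV : IsCancellableElement V) :
    (V : SemigroupVariety.{u}).IsGreedy := by
  rintro l ⟨u, hu, v, hv, hne, huv⟩
  have hperm := Part.perm_of_mem_transversal hu hv
  have hne' := Word.letters_injective.ne hne
  have key (w : Word) (hw : w ∈ l.transversal) :
      (V : SemigroupVariety.{u}).SatisfiesList u.letters w.letters := by
    have hd := Part.perm_of_mem_transversal hu hw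
    by_cases hnd : u.letters.Nodup
    · exact satisfiesList_of_nodup hV hnd hperm hne' (satisfies_iff.1 huv) hd
    · exact satisfiesList_of_not_nodup hV hnd hperm hne' (satisfies_iff.1 huv) hd
  exact fun w hw w' hw' => satisfies_iff.2 ((key w hw).symm.trans (key w' hw'))

end SemigroupVariety

/-! ### Adding linear letters to a collapsed type -/

/-- Each letter with `P` is followed by one without. A first letter without `P` is not needed as a
successor, which gives the strict inequality. -/
theorem countP_le_of_isolated (P : ℕ → Bool) (l : List ℕ)
    (hadj : ∀ a x y b, l = a ++ x :: y :: b → P x → P y → False)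
    (hlast : ∀ a x, l = a ++ [x] → P x → False) :
    l.countP P ≤ l.countP (fun x => !P x) ∧
      ∀ x t, l = x :: t → ¬ P x → l.countP P < l.countP (fun x => !P x) := by
  induction l with
  | nil => simp
  | cons x t ih =>
    obtain ⟨h₁, h₂⟩ := ih (fun a y z b h => hadj (x :: a) y z b (by rw [h]; rfl))
      (fun a y h => hlast (x :: a) y (by rw [h]; rfl))
    by_cases hx : P x
    · refine ⟨?_, fun y t' h hy => ?_⟩
      · cases t with
        | nil => exact (hlast [] x rfl hx).elim
        | cons y t' =>
          have := h₂ y t' rfl fun hy => hadj [] x y t' rfl hx hy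
          simp only [List.countP_cons (a := x), hx]
          simp only [if_true, Bool.not_true, Bool.false_eq_true, if_false]
          lia
      · rw [(List.cons.inj h).1] at hx
        exact absurd hx hy
    · simp only [List.countP_cons, hx]
      simp only [Bool.not_false, if_true, Bool.false_eq_true, if_false]
      exact ⟨by lia, fun _ _ _ _ => by lia⟩

/-- If at least half of the letters of a word satisfy `P`, then the word begins or ends with such a
letter or has two such letters in a row. -/
theorem exists_begin_or_end_or_adjacent (P : ℕ → Bool) {l : List ℕ} (hl : l ≠ [])
    (h : l.countP (fun x => !P x) ≤ l.countP P) :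
    (∃ x t, l = x :: t ∧ P x) ∨ (∃ a x, l = a ++ [x] ∧ P x) ∨
      ∃ a x y b, l = a ++ x :: y :: b ∧ P x ∧ P y := by
  by_contra hcon
  push Not at hcon
  obtain ⟨h₁, h₂, h₃⟩ := hcon
  obtain ⟨x, t, rfl⟩ := List.exists_cons_of_ne_nil hl
  have := (countP_le_of_isolated P (x :: t) (fun a y z b h h' h'' => h₃ a y z b h h' h'')
    (fun a y h h' => h₂ a y h h')).2 x t rfl (h₁ x t rfl)
  lia

theorem countP_eq_sum (P : ℕ → Bool) (l : List ℕ) :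
    l.countP P = ∑ a ∈ l.toFinset.filter (fun a => P a), l.count a := by
  rw [List.countP_eq_length_filter, ← List.sum_toFinset_count_eq_length, List.toFinset_filter]
  refine Finset.sum_congr rfl fun a ha => ?_
  rw [List.count_filter (Finset.mem_filter.1 ha).2]

theorem card_filter_count_eq_one (l : List ℕ) :
    (l.toFinset.filter fun a => l.count a = 1).card = (letterCounts l).count 1 := by
  rw [letterCounts, Multiset.count_map, Finset.card_def, Finset.filter_val]
  simp only [eq_comm]

theorem countP_linear (l : List ℕ) :
    l.countP (fun a => decide (l.count a = 1)) = (letterCounts l).count 1 := by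
  rw [countP_eq_sum, ← card_filter_count_eq_one, Finset.card_eq_sum_ones]
  simp only [decide_eq_true_eq]
  exact Finset.sum_congr rfl fun a ha => (Finset.mem_filter.1 ha).2

theorem countP_nonlinear (l : List ℕ) :
    l.countP (fun a => !decide (l.count a = 1)) = ((letterCounts l).filter (1 < ·)).sum := by
  rw [countP_eq_sum, letterCounts, Multiset.filter_map]
  change ((Finset.filter _ _).val.map _).sum = _
  rw [Finset.filter_val]
  congr 2
  refine Multiset.filter_congr fun a ha => ?_
  have : 0 < l.count a := List.count_pos_iff.2 (List.mem_toFinset.1 ha)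
  simp only [Bool.not_eq_true', decide_eq_false_iff_not, Function.comp_apply]
  lia

theorem flatMap_letters_of_notMem {x : ℕ} {w : Word} {l : List ℕ} (hx : x ∉ l) :
    (l.flatMap fun i => (if i = x then w else FreeSemigroup.of i).letters) = l := by
  induction l with
  | nil => rfl
  | cons a l ih =>
    rw [List.mem_cons, not_or] at hx
    rw [List.flatMap_cons, ih hx.2, if_neg fun h => hx.1 h.symm]
    rfl

namespace SemigroupVariety

variable {V : SemigroupVariety.{u}}

/-- By `hcount`, every rearrangement of `w` begins or ends with a linear letter or has two adjacent
ones. In each case collapsing a word with one linear letter removed brings a linear letter to the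
front, and three linear letters suffice to connect all such words. -/
theorem satisfiesList_of_linear_letters {w w' : List ℕ} {T : Finset ℕ}
    (hT : ∀ t, t ∈ T ↔ w.count t = 1) (hcard : 3 ≤ T.card)
    (hcount : w.countP (fun x => !decide (w.count x = 1)) ≤
      w.countP fun x => decide (w.count x = 1))
    (H : ∀ t ∈ T, ∀ l l', l.Perm (w.erase t) → l.Perm l' → V.SatisfiesList l l')
    (hw' : w.Perm w') : V.SatisfiesList w w' := by
  have hmem {t : ℕ} (ht : t ∈ T) : t ∈ w := List.count_pos_iff.1 (by rw [(hT t).1 ht]; simp)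
  have hthird (x y : ℕ) : ∃ t ∈ T, t ≠ x ∧ t ≠ y := by
    obtain ⟨t, ht, h⟩ := Finset.exists_mem_notMem_of_card_lt_card
      (lt_of_le_of_lt (Finset.card_le_two (a := x) (b := y)) hcard)
    exact ⟨t, ht, by simpa using h⟩
  -- Both words are equivalent to one that begins with `x` and ends with `y`.
  have hbe {x y : ℕ} (hx : x ∈ T) (hy : y ∈ T) (hxy : x ≠ y) :
      V.SatisfiesList (x :: w.erase x) (w.erase y ++ [y]) := by
    have hy' : y ∈ w.erase x := (List.mem_erase_of_ne hxy.symm).2 (hmem hy)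
    have hx' : x ∈ w.erase y := (List.mem_erase_of_ne hxy).2 (hmem hx)
    have h₁ := (H x hx _ _ (.refl _) ((List.perm_cons_erase hy').trans
      (List.perm_append_singleton _ _).symm)).append_left [x]
    have h₂ := (H y hy _ _ (.refl _) (List.perm_cons_erase hx')).append_right [y]
    rw [List.erase_comm] at h₂
    exact h₁.trans h₂.symm
  have hbb {x y : ℕ} (hx : x ∈ T) (hy : y ∈ T) :
      V.SatisfiesList (x :: w.erase x) (y :: w.erase y) := by
    obtain ⟨t, ht, htx, hty⟩ := hthird x y
    exact (hbe hx ht htx.symm).trans (hbe hy ht hty.symm).symm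
  have hbegin {x : ℕ} {t : List ℕ} (hx : x ∈ T) (h : w.Perm (x :: t)) :
      V.SatisfiesList (x :: t) (x :: w.erase x) := by
    have h₁ : (w.erase x).Perm t := ((List.perm_cons_erase (hmem hx)).symm.trans h).cons_inv
    exact (H x hx _ _ h₁.symm h₁.symm).append_left [x]
  have hreach {v : List ℕ} (hv : w.Perm v) : ∃ x ∈ T, V.SatisfiesList v (x :: w.erase x) := by
    have hnil : v ≠ [] := by
      rintro rfl
      obtain ⟨t, ht, -⟩ := hthird 0 0
      simpa [hv.eq_nil] using hmem ht
    have hPT {x : ℕ} (hx : decide (w.count x = 1) = true) : x ∈ T :=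
      (hT x).2 (of_decide_eq_true hx)
    rcases exists_begin_or_end_or_adjacent (fun x => decide (w.count x = 1)) hnil
      (by rwa [← hv.countP_eq, ← hv.countP_eq]) with
      ⟨x, t, rfl, hx⟩ | ⟨a, x, rfl, hx⟩ | ⟨a, x, y, b, rfl, hx, hy⟩
    · exact ⟨x, hPT hx, hbegin (hPT hx) hv⟩
    · have hx := hPT hx
      have h₁ : (w.erase x).Perm a := ((List.perm_cons_erase (hmem hx)).symm.trans
        (hv.trans (List.perm_append_singleton _ _))).cons_inv
      obtain ⟨t, ht, htx, -⟩ := hthird x x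
      exact ⟨t, ht, ((H x hx _ _ h₁.symm h₁.symm).append_right [x]).trans (hbe ht hx htx).symm⟩
    · have hx := hPT hx
      have hy := hPT hy
      have h₀ : (a ++ x :: y :: b).Perm (y :: (a ++ x :: b)) := by
        simpa using List.perm_middle (l₁ := a ++ [x]) (l₂ := b) (a := y)
      have h₁ : (w.erase y).Perm (a ++ x :: b) := ((List.perm_cons_erase (hmem hy)).symm.trans
        (hv.trans h₀)).cons_inv
      -- The block `xy` is treated as one letter: in the word without `y`, the letter `x` moves to
      -- the front, and then `xy` is substituted for `x`.
      have h₂ := (H y hy _ (x :: (a ++ b)) h₁.symm List.perm_middle).flatMap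
        fun i => if i = x then ⟨x, [y]⟩ else FreeSemigroup.of i
      have hc : (a ++ x :: y :: b).count x = 1 := by rw [← hv.count_eq]; exact (hT x).1 hx
      rw [List.count_append, List.count_cons_self] at hc
      have hxa : x ∉ a := List.count_eq_zero.1 (by lia)
      have hxb : x ∉ b := fun h => by
        have : 0 < (y :: b).count x := List.count_pos_iff.2 (List.mem_cons_of_mem _ h)
        lia
      have hxab : x ∉ a ++ b := by simp [hxa, hxb]
      rw [List.flatMap_append, List.flatMap_cons, List.flatMap_cons,
        flatMap_letters_of_notMem hxa, flatMap_letters_of_notMem hxb,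
        flatMap_letters_of_notMem hxab, if_pos rfl] at h₂
      have h₃ : w.Perm (x :: y :: (a ++ b)) :=
        hv.trans (h₀.trans ((List.perm_middle.cons y).trans (.swap _ _ _)))
      exact ⟨x, hx, SatisfiesList.trans h₂ (hbegin hx h₃)⟩
  obtain ⟨x, hx, h₁⟩ := hreach (.refl w)
  obtain ⟨y, hy, h₂⟩ := hreach hw'
  exact (h₁.trans (hbb hx hy)).trans h₂.symm

/-- `V` satisfies all balanced identities between words whose letters have the multiplicities
`μ`. -/
def CollapsesCounts (V : SemigroupVariety.{u}) (μ : Multiset ℕ) : Prop :=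
  ∀ p p' : List ℕ, letterCounts p = μ → p.Perm p' → V.SatisfiesList p p'

theorem CollapsesCounts.cons_one {μ : Multiset ℕ} (h : V.CollapsesCounts μ)
    (hq : 2 ≤ μ.count 1) (hr : (μ.filter (1 < ·)).sum ≤ μ.count 1 + 1) :
    V.CollapsesCounts (1 ::ₘ μ) := by
  intro w w' hw hww'
  refine satisfiesList_of_linear_letters (T := w.toFinset.filter fun a => w.count a = 1)
    (fun t => ?_) ?_ ?_ (fun t ht l l' hl hll' => h l l' ?_ hll') hww'
  · rw [Finset.mem_filter, List.mem_toFinset, and_iff_right_iff_imp]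
    intro h
    exact List.count_pos_iff.1 (by lia)
  · rw [card_filter_count_eq_one, hw, Multiset.count_cons_self]
    lia
  · rw [countP_linear, countP_nonlinear, hw, Multiset.count_cons_self,
      Multiset.filter_cons_of_neg _ (by simp)]
    exact hr
  · rw [Finset.mem_filter, List.mem_toFinset] at ht
    have ht' : t ∉ w.erase t := List.count_eq_zero.1 (by rw [List.count_erase_self, ht.2])
    rw [letterCounts_perm (List.perm_cons_erase ht.1), letterCounts_cons ht'] at hw
    rw [letterCounts_perm hl]
    exact (Multiset.cons_inj_right _).1 hw

namespace Part

variable {l : Part}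

theorem coe_parts_appendOnes (l : Part) (k : ℕ) :
    ((l.appendOnes k).parts : Multiset ℕ) = (l.parts : Multiset ℕ) + Multiset.replicate k 1 := by
  rw [← Multiset.coe_replicate, Multiset.coe_add]
  rfl

theorem length_parts (l : Part) : l.parts.length = (l.parts.filter (1 < ·)).length + l.q := by
  have h := l.pos
  rw [q]
  generalize l.parts = μ at h
  induction μ with
  | nil => rfl
  | cons a μ ih =>
    have h₁ := ih fun b hb => h b (List.mem_cons_of_mem _ hb)
    have h₂ := h a (by simp)
    by_cases ha : a = 1
    · subst ha
      simp only [List.length_cons, List.filter_cons, List.count_cons_self, lt_irrefl,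
        decide_false, Bool.false_eq_true, if_false]
      lia
    · have : 1 < a := by lia
      simp only [List.length_cons, List.filter_cons, List.count_cons_of_ne ha, this,
        decide_true, if_true]
      lia

theorem two_mul_length_le_r (l : Part) : 2 * (l.parts.filter (1 < ·)).length ≤ l.r := by
  have h := List.card_nsmul_le_sum (l.parts.filter (1 < ·)) 2 fun a ha => by
    have : 1 < a := by simpa using (List.mem_filter.1 ha).2
    exact this
  rw [smul_eq_mul] at h
  rw [r]
  lia

theorem sum_parts (l : Part) : l.parts.sum = l.r + l.q := by
  have h := l.pos
  rw [q, r]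
  generalize l.parts = μ at h
  induction μ with
  | nil => rfl
  | cons a μ ih =>
    have h₁ := ih fun b hb => h b (List.mem_cons_of_mem _ hb)
    have h₂ := h a (by simp)
    by_cases ha : a = 1
    · subst ha
      simp only [List.sum_cons, List.filter_cons, List.count_cons_self, lt_irrefl,
        decide_false, Bool.false_eq_true, if_false]
      lia
    · have : 1 < a := by lia
      simp only [List.filter_cons, List.count_cons_of_ne ha, this,
        decide_true, if_true, List.sum_cons]
      lia

theorem eq_two_one (hr : l.r = 2) (hq : l.q = 1) : l.parts = [2, 1] := by
  have h₁ := l.two_mul_length_le_r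
  have h₂ := l.length_parts
  have h₃ := l.two_le
  have h₄ := l.sum_parts
  have h₅ := l.sorted
  have h₆ := l.pos
  rw [hr, hq] at h₄
  obtain ⟨a, b, hab⟩ := List.length_eq_two.1 (show l.parts.length = 2 by lia)
  rw [hab] at h₄ h₅ h₆ ⊢
  simp at h₄ h₅ h₆
  obtain ⟨rfl, rfl⟩ : a = 2 ∧ b = 1 := by lia
  rfl

/-- This is what `s` is designed for: from `k = s` on, `CollapsesCounts.cons_one` applies. The bound
`r ≤ q + k + 1` already gives two linear letters, except for `(2, 1)` with `k = 0`, which `delta`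
excludes. -/
theorem two_le_of_s_le {k : ℕ} (hk : l.s ≤ k) : 2 ≤ l.q + k ∧ l.r ≤ l.q + k + 1 := by
  have h₁ := l.two_mul_length_le_r
  have h₂ := l.length_parts
  have h₃ := l.two_le
  rw [s, delta] at hk
  split_ifs at hk with h
  · have hq : l.q = 1 := by rw [q, h]; rfl
    have hr : l.r = 2 := by rw [r, h]; rfl
    rw [hq, hr] at hk ⊢
    norm_num at hk
    lia
  · have h₄ : l.r ≤ l.q + k + 1 := by lia
    refine ⟨?_, h₄⟩
    by_contra hlt
    have h₅ : l.q = 1 := by lia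
    by_cases h₆ : l.r = 2
    · exact h (eq_two_one h₆ h₅)
    · lia

theorem satisfies_varietyW_collapses (l : Part) : l.varietyW.Collapses l :=
  fun _ hu _ hv => satisfies_var_of_mem ⟨hu, hv⟩

/-- Up to `s` added ones the identities are part of the definition; beyond `s`, each further one
comes by induction. -/
theorem collapsesCounts_varietyS (l : Part) (k : ℕ) :
    (l.varietyS.{u}).CollapsesCounts ((l.parts : Multiset ℕ) + Multiset.replicate k 1) := by
  have hle (k : ℕ) (hk : k ≤ l.s) :
      (l.varietyS.{u}).CollapsesCounts ((l.parts : Multiset ℕ) + Multiset.replicate k 1) := by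
    intro p p' hp hpp'
    rw [← coe_parts_appendOnes] at hp
    refine (collapses_iff.1 (satisfies_varietyW_collapses _) p p' hp hpp').mono ?_
    exact Finset.inf_le (f := fun i => (l.appendOnes i).varietyW)
      (Finset.mem_range.2 (Nat.lt_succ_of_le hk))
  rcases le_total k l.s with hk | hk
  · exact hle k hk
  induction k, hk using Nat.le_induction with
  | base => exact hle _ le_rfl
  | succ k hk ih =>
    obtain ⟨h₁, h₂⟩ := two_le_of_s_le hk
    have hq : ((l.parts : Multiset ℕ) + Multiset.replicate k 1).count 1 = l.q + k := by
      rw [Multiset.count_add, Multiset.coe_count, Multiset.count_replicate_self]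
      rfl
    have hr : (((l.parts : Multiset ℕ) + Multiset.replicate k 1).filter (1 < ·)).sum = l.r := by
      have h₀ : (Multiset.replicate k 1).filter (1 < ·) = 0 := Multiset.filter_eq_nil.2
        fun a ha => by simp [Multiset.eq_of_mem_replicate ha]
      rw [Multiset.filter_add, h₀, add_zero, Multiset.filter_coe, Multiset.sum_coe]
      rfl
    rw [Multiset.replicate_succ, Multiset.add_cons]
    exact ih.cons_one (hq ▸ h₁) (by rw [hq, hr]; exact h₂)

/-! ### Domination and the identities of meets of the varieties `varietyS` -/

/-- Some part of the word `x` is the image of a word of the type `l` under an identification of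
letters. -/
def Dominates (l : Part) (x : List ℕ) : Prop :=
  ∃ (p : List ℕ) (f : ℕ → ℕ) (c : List ℕ), letterCounts p = l.parts ∧ x.Perm (p.map f ++ c)

theorem Dominates.perm {x y : List ℕ} (h : l.Dominates x) (hxy : x.Perm y) : l.Dominates y :=
  let ⟨p, f, c, hp, hx⟩ := h
  ⟨p, f, c, hp, hxy.symm.trans hx⟩

theorem Dominates.append {x : List ℕ} (h : l.Dominates x) (a b : List ℕ) :
    l.Dominates (a ++ x ++ b) := by
  obtain ⟨p, f, c, hp, hx⟩ := h
  refine ⟨p, f, c ++ (a ++ b), hp, ?_⟩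
  rw [← List.append_assoc]
  refine List.Perm.trans ?_ (hx.append_right (a ++ b))
  rw [← List.append_assoc]
  exact List.perm_append_comm.append_right b

end Part

theorem exists_fresh_extension (p : List ℕ) (f : ℕ → ℕ) (c : List ℕ) :
    ∃ (q : List ℕ) (g : ℕ → ℕ), letterCounts q = letterCounts p + Multiset.replicate c.length 1 ∧
      q.map g = p.map f ++ c := by
  induction c using List.reverseRecOn with
  | nil => exact ⟨p, f, by simp, by simp⟩
  | append_singleton c x ih =>
    obtain ⟨q, g, h₁, h₂⟩ := ih
    obtain ⟨y, hy⟩ := Infinite.exists_notMem_finset q.toFinset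
    rw [List.mem_toFinset] at hy
    refine ⟨q ++ [y], Function.update g y x, ?_, ?_⟩
    · rw [letterCounts_perm (List.perm_append_singleton y q), letterCounts_cons hy, h₁,
        List.length_append, List.length_singleton, Multiset.replicate_succ, Multiset.add_cons]
    · rw [List.map_append, List.map_singleton, Function.update_self, ← List.append_assoc, ← h₂]
      congr 1
      exact List.map_congr_left fun z hz => Function.update_of_ne (by rintro rfl; exact hy hz) _ _

/-- The letters of the remainder `c` are replaced by distinct fresh ones. This lifts `x` and `y` to
rearrangements of a word whose type is `l` with ones added; identifying letters again gives `x ≈ y`.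
-/
theorem satisfiesList_of_dominates {l : Part}
    (hV : ∀ k, V.CollapsesCounts ((l.parts : Multiset ℕ) + Multiset.replicate k 1)) {x y : List ℕ}
    (hx : l.Dominates x) (hxy : x.Perm y) : V.SatisfiesList x y := by
  obtain ⟨p, f, c, hp, hxp⟩ := hx
  obtain ⟨q, g, h₁, h₂⟩ := exists_fresh_extension p f c
  rw [← h₂] at hxp
  obtain ⟨x', rfl, hx'⟩ := (congrFun₂ (List.eq_map_comp_perm g) x q).mpr hxp
  obtain ⟨y', rfl, hy'⟩ := (congrFun₂ (List.eq_map_comp_perm g) y q).mpr (hxy.symm.trans hxp)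
  exact (hV c.length x' y' (by rw [letterCounts_perm hx', h₁, hp])
    (hx'.trans hy'.symm)).map g

/-- From each letter matched with a part of `μ`, that many occurrences go into `p`; all other
occurrences go into `c`. -/
theorem exists_perm_append_of_sublistForall₂ {μ ν : List ℕ} (h : List.SublistForall₂ (· ≤ ·) μ ν)
    (hμ : ∀ a ∈ μ, 0 < a) {x : List ℕ} (hx : letterCounts x = ν) :
    ∃ p c, letterCounts p = μ ∧ x.Perm (p ++ c) := by
  induction h generalizing x with
  | nil => exact ⟨[], x, rfl, .refl _⟩
  | @cons a b μ ν hab _ ih =>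
    obtain ⟨t, x', hp, ht, hx'⟩ := exists_perm_replicate_append (b := b) (s := ν) hx
    obtain ⟨p, c, h₁, h₂⟩ := ih (fun a ha => hμ a (List.mem_cons_of_mem _ ha)) hx'
    have htp : t ∉ p := fun h => ht (h₂.mem_iff.2 (List.mem_append_left _ h))
    refine ⟨List.replicate a t ++ p, List.replicate (b - a) t ++ c, ?_, ?_⟩
    · rw [letterCounts_replicate_append (hμ a (by simp)) htp, h₁]
      rfl
    · have h₃ : List.replicate b t = List.replicate a t ++ List.replicate (b - a) t := by
        rw [← List.replicate_add, Nat.add_sub_cancel' hab]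
      rw [h₃] at hp
      refine hp.trans ((h₂.append_left _).trans ?_)
      rw [List.append_assoc, List.append_assoc]
      refine List.Perm.append_left _ ?_
      rw [← List.append_assoc, ← List.append_assoc]
      exact List.perm_append_comm.append_right c
  | @cons_right b μ ν _ ih =>
    obtain ⟨t, x', hp, ht, hx'⟩ := exists_perm_replicate_append (b := b) (s := ν) hx
    obtain ⟨p, c, h₁, h₂⟩ := ih hμ hx'
    refine ⟨p, List.replicate b t ++ c, h₁, hp.trans ((h₂.append_left _).trans ?_)⟩
    rw [← List.append_assoc, ← List.append_assoc]
    exact List.perm_append_comm.append_right c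

theorem Part.dominates_of_sublistForall₂ {l : Part} {ν : List ℕ}
    (h : List.SublistForall₂ (· ≤ ·) l.parts ν) {x : List ℕ} (hx : letterCounts x = ν) :
    l.Dominates x := by
  obtain ⟨p, c, h₁, h₂⟩ := exists_perm_append_of_sublistForall₂ h l.pos hx
  exact ⟨p, id, c, h₁, by simpa using h₂⟩

theorem Part.Dominates.flatMap {l : Part} {x : List ℕ} (h : l.Dominates x) (φ : ℕ → Word) :
    l.Dominates (x.flatMap fun i => (φ i).letters) := by
  obtain ⟨p, f, c, hp, hx⟩ := h
  have h₁ : ((p.map f).flatMap fun i => (φ i).letters).Perm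
      (p.map (fun i => (φ (f i)).head) ++ (p.map f).flatMap fun i => (φ i).tail) := by
    have h₂ := (List.flatMap_append_perm (p.map f) (fun i => [(φ i).head])
      (fun i => (φ i).tail)).symm
    have h₃ : (p.map f).flatMap (fun i => [(φ i).head]) = p.map fun i => (φ (f i)).head := by
      rw [← List.map_eq_flatMap, List.map_map]
      rfl
    rwa [h₃] at h₂
  refine ⟨p, fun i => (φ (f i)).head,
    ((p.map f).flatMap fun i => (φ i).tail) ++ c.flatMap fun i => (φ i).letters, hp, ?_⟩
  refine (hx.flatMap_right _).trans ?_
  rw [List.flatMap_append, ← List.append_assoc]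
  exact h₁.append_right _

/-- Domination is preserved by rearrangement, contexts and substitution, so the right-hand side
describes a congruence containing all instances of the defining identities. Conversely,
`satisfiesList_of_dominates` derives every such identity. -/
theorem satisfies_inf_varietyS {ι : Type*} (s : Finset ι) (l : ι → Part) {u v : Word} :
    (s.inf fun i => (l i).varietyS : SemigroupVariety.{u}).Satisfies (u, v) ↔
      u.letters.Perm v.letters ∧
        (u.letters = v.letters ∨ ∃ i ∈ s, (l i).Dominates u.letters) := by
  constructor
  · intro h
    let r : List ℕ → List ℕ → Prop := fun x y => x.Perm y ∧ (x = y ∨ ∃ i ∈ s, (l i).Dominates x)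
    have hr : Equivalence r := by
      refine ⟨fun x => ⟨.refl x, Or.inl rfl⟩, ?_, ?_⟩
      · rintro x y ⟨hp, rfl | ⟨i, hi, h⟩⟩
        · exact ⟨hp, Or.inl rfl⟩
        · exact ⟨hp.symm, Or.inr ⟨i, hi, h.perm hp⟩⟩
      · rintro x y z ⟨hp, rfl | ⟨i, hi, h⟩⟩ ⟨hp', h'⟩
        · exact ⟨hp', h'⟩
        · exact ⟨hp.trans hp', Or.inr ⟨i, hi, h⟩⟩
    have happ (a b x y : List ℕ) (hxy : r x y) : r (a ++ x ++ b) (a ++ y ++ b) := by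
      obtain ⟨hp, h⟩ := hxy
      refine ⟨(hp.append_left a).append_right b, h.imp (congrArg fun z => a ++ z ++ b) ?_⟩
      rintro ⟨i, hi, h⟩
      exact ⟨i, hi, h.append a b⟩
    -- Allowing every number `j` of ones only enlarges the system; words of all these types are
    -- dominated by `l i`.
    let E : Set (Word × Word) :=
      {e | ∃ i ∈ s, ∃ j, e ∈ ((l i).appendOnes j).transversal ×ˢ ((l i).appendOnes j).transversal}
    have hE : var.{u} E ≤ s.inf fun i => (l i).varietyS := Finset.le_inf fun i hi =>
      Finset.le_inf fun j _ S _ hS e he => hS e ⟨i, hi, j, he⟩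
    refine rel_of_satisfies_var (E := E) (c := Word.conOfList r hr happ) ?_
      fun S _ hS => h S (hE S hS)
    rintro ⟨x, y⟩ ⟨i, hi, j, hx, hy⟩ φ
    change r (Word.letters _) (Word.letters _)
    rw [Word.letters_lift, Word.letters_lift]
    refine ⟨(Part.perm_of_mem_transversal hx hy).flatMap_right _, Or.inr ⟨i, hi, ?_⟩⟩
    refine Part.Dominates.flatMap (Part.dominates_of_sublistForall₂ ?_
      (Part.letterCounts_of_mem_transversal hx)) φ
    exact (List.sublist_append_left _ _).sublistForall₂
  · rintro ⟨hp, h | ⟨i, hi, h⟩⟩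
    · rw [satisfies_iff, h]
      exact .refl _ _
    · exact satisfies_iff.2 ((satisfiesList_of_dominates (l i).collapsesCounts_varietyS h hp).mono
        (Finset.inf_le (f := fun i => (l i).varietyS) hi))

/-! ### Greedy varieties as finite meets of the varieties `varietyS` -/

theorem isGreedy_inf_varietyS {ι : Type*} (s : Finset ι) (l : ι → Part) :
    (s.inf fun i => (l i).varietyS : SemigroupVariety.{u}).IsGreedy := by
  rintro m ⟨u, hu, v, hv, hne, huv⟩ w hw w' hw'
  obtain ⟨i, hi, h⟩ := ((satisfies_inf_varietyS s l).1 huv).2.resolve_left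
    (Word.letters_injective.ne hne)
  exact (satisfies_inf_varietyS s l).2 ⟨Part.perm_of_mem_transversal hw hw',
    Or.inr ⟨i, hi, h.perm (Part.perm_of_mem_transversal hu hw)⟩⟩

theorem isGreedy_SEM : SEM.{u}.IsGreedy := by
  have := isGreedy_inf_varietyS.{u} (∅ : Finset Part) id
  rwa [Finset.inf_empty] at this

/-- Multiplying a nontrivial identity by a fresh letter yields a nontrivial identity of the type
with one more part `1`, which greediness turns into collapse. -/
theorem IsGreedy.collapsesCounts (hV : V.IsGreedy) {l : Part} (h : V.Collapses l) (k : ℕ) :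
    V.CollapsesCounts ((l.parts : Multiset ℕ) + Multiset.replicate k 1) := by
  induction k with
  | zero =>
    rw [Multiset.replicate_zero, add_zero]
    exact collapses_iff.1 h
  | succ k ih =>
    obtain ⟨p, hp⟩ := exists_letterCounts_eq (l.appendOnes k).parts (l.appendOnes k).pos
    obtain ⟨x, y, hxp, hyp, hxy⟩ : ∃ x y, x ∈ p ∧ y ∈ p ∧ x ≠ y := by
      have hcard : 1 < p.toFinset.card := by
        have h₁ := congrArg Multiset.card hp
        rw [letterCounts, Multiset.card_map, Multiset.coe_card] at h₁
        have h₂ := (l.appendOnes k).two_le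
        change p.toFinset.card = _ at h₁
        lia
      simpa using Finset.one_lt_card_iff.1 hcard
    obtain ⟨z, hz⟩ := Infinite.exists_notMem_finset p.toFinset
    rw [List.mem_toFinset] at hz
    have h₁ := List.perm_cons_erase hxp
    have h₂ := List.perm_cons_erase hyp
    have h₃ : (x :: p.erase x).Perm (y :: p.erase y) := h₁.symm.trans h₂
    rw [Part.coe_parts_appendOnes] at hp
    have h₄ := (ih _ _ ((letterCounts_perm h₁.symm).trans hp) h₃).append_left [z]
    intro q q' hq hqq'
    refine hV.satisfiesList (h₃.append_left [z]) (by simp [hxy]) h₄ ?_ hqq'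
    rw [hq, List.singleton_append, letterCounts_perm (h₁.symm.cons z), letterCounts_cons hz, hp,
      Multiset.replicate_succ, Multiset.add_cons]

theorem IsGreedy.le_varietyS (hV : V.IsGreedy) {l : Part} (h : V.Collapses l) :
    V ≤ l.varietyS := by
  refine Finset.le_inf fun j _ S _ hS => ?_
  rintro ⟨u, v⟩ ⟨hu, hv⟩
  have h₁ := hV.collapsesCounts h j
  rw [← Part.coe_parts_appendOnes] at h₁
  exact (collapses_iff.2 h₁) u hu v hv S hS

/-- Every set of partitions has a finite subset of lower bounds for all its elements. -/
theorem exists_finset_sublistForall₂ (C : Set Part) : ∃ F : Finset Part, (∀ l ∈ F, l ∈ C) ∧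
    ∀ l ∈ C, ∃ m ∈ F, List.SublistForall₂ (· ≤ ·) m.parts l.parts := by
  by_contra hcon
  push Not at hcon
  obtain ⟨f, -, hf⟩ := exists_seq_of_forall_finset_exists (fun l => l ∈ C)
    (fun m l : Part => ¬ List.SublistForall₂ (· ≤ ·) m.parts l.parts) hcon
  -- Higman's lemma over `ℕ`: a sequence of partitions with no term embedded in a later one cannot
  -- be infinite.
  have hpwo := Set.PartiallyWellOrderedOn.partiallyWellOrderedOn_sublistForall₂ (· ≤ ·)
    (Set.isPWO_of_wellQuasiOrderedLE (Set.univ : Set ℕ))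
  obtain ⟨m, n, hmn, h⟩ := hpwo fun n => ⟨(f n).parts, by simp⟩
  exact hf m n hmn h

theorem IsGreedy.eq_SEM_or_eq_inf (hov : V.IsOvercommutative) (hV : V.IsGreedy) :
    V = SEM ∨ ∃ (k : ℕ) (_ : 0 < k) (l : Fin k → Part),
      V = Finset.univ.inf fun i => (l i).varietyS := by
  have hpart {u v : Word} (h : V.Satisfies (u, v)) (hne : u ≠ v) :
      ∃ l : Part, V.Collapses l ∧ letterCounts u.letters = l.parts := by
    have hp := hov.perm h
    have hne' := Word.letters_injective.ne hne
    obtain ⟨l, hl⟩ := Part.exists_part hp hne'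
    exact ⟨l, hV l (reduces_iff.2 ⟨_, _, hl, hp, hne', satisfies_iff.1 h⟩), hl⟩
  by_cases hC : ∃ l, V.Collapses l
  · right
    -- The meet is taken over a finite set of collapsed partitions lying below all collapsed ones.
    -- Any nontrivial identity of `V` has a collapsed type, so its words are dominated by a member
    -- of `F`.
    obtain ⟨F, hF, hF'⟩ := exists_finset_sublistForall₂ {l | V.Collapses l}
    refine ⟨F.card, ?_, fun i => F.equivFin.symm i, ?_⟩
    · obtain ⟨l, hl⟩ := hC
      obtain ⟨m, hm, -⟩ := hF' l hl
      exact Finset.card_pos.2 ⟨m, hm⟩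
    · refine le_antisymm (Finset.le_inf fun i _ => hV.le_varietyS (hF _ (F.equivFin.symm i).2))
        (le_iff_satisfies.2 fun u v h => ?_)
      refine (satisfies_inf_varietyS _ _).2 ⟨hov.perm h, ?_⟩
      by_cases hne : u = v
      · exact Or.inl (hne ▸ rfl)
      · obtain ⟨l, hl, hul⟩ := hpart h hne
        obtain ⟨m, hm, hml⟩ := hF' l hl
        exact Or.inr ⟨F.equivFin ⟨m, hm⟩, Finset.mem_univ _, by
          simpa using Part.dominates_of_sublistForall₂ hml hul⟩
  · left
    refine le_antisymm le_top (le_iff_satisfies.2 fun u v h => ?_)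
    by_cases hne : u = v
    · rw [hne, satisfies_iff]
      exact .refl _ _
    · obtain ⟨l, hl, -⟩ := hpart h hne
      exact absurd ⟨l, hl⟩ hC

end SemigroupVariety

theorem theorem2p2 (V : SemigroupVariety.OC.{u}) :
    List.TFAE [
      IsCancellableElement V,
      (V : SemigroupVariety.{u}).IsGreedy,
      (V : SemigroupVariety.{u}) = SemigroupVariety.SEM ∨
        ∃ (k : ℕ) (_ : 0 < k) (l : Fin k → SemigroupVariety.Part),
          (V : SemigroupVariety.{u}) = Finset.univ.inf fun i => (l i).varietyS] := by
  tfae_have 1 → 2 := SemigroupVariety.isGreedy_of_isCancellableElement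
  tfae_have 2 → 1 := SemigroupVariety.IsGreedy.isCancellableElement
  tfae_have 2 → 3 := SemigroupVariety.IsGreedy.eq_SEM_or_eq_inf V.2
  tfae_have 3 → 2 := by
    rintro (h | ⟨k, -, l, h⟩)
    · exact h ▸ SemigroupVariety.isGreedy_SEM
    · exact h ▸ SemigroupVariety.isGreedy_inf_varietyS _ _
  tfae_finish
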